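/- Let $\lambda_b>0$, $R=(\pi\lambda_b)^{-1/2}$, $\mathcal A=B(0,R)\subset\mathbb R^2$, $\tau>2$, $\delta=2/\tau$, $\mu>0$, $\bar w>0$, $s>0$. On a probability space let $X_0,X_1,\dots$ be random points of the plane which form, on $\mathcal A^c$, a homogeneous Poisson point process of intensity $\lambda_b$, and let $(L_j,G_j)_{j\ge 0}$ be i.i.d. pairs, independent of $(X_j)_j$, where for each $j$ the variables $L_j$ and $G_j$ are independent and $L_j$ has density $2\pi\lambda_b x$ on $[0,R]$. Put $$I_c=\sum_{j:\,X_j\in\mathcal A^c} L_j^{\tau}\,G_j\,\|X_j\|^{-\tau}.$$ Write $I_\nu$ for the modified Bessel function of the first kind and $$G^{2,1}_{2,2}\!\left(z\,\Big|\,{a_1,a_2\atop b_1,b_2}\right)=\frac1{2\pi i}\int_{c-i\infty}^{c+i\infty}\frac{\Gamma(b_1-u)\Gamma(b_2-u)\Gamma(1-a_1+u)}{\Gamma(a_2-u)}z^u\,du,\qquad a_1-1<c<\min(b_1,b_2),$$ for the Meijer $G$-function. Assume one of the following. ($\kappa$-$\mu$ fading) $\kappa>0$, each $G_j$ has on $(0,\infty)$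 the density $$\frac{\mu}{\kappa^{\frac{\mu-1}2}e^{\mu\kappa}}\Big(\frac{1+\kappa}{\bar w}\Big)^{\frac{\mu+1}2}x^{\frac{\mu-1}2}\exp\Big(-\frac{\mu(1+\kappa)}{\bar w}x\Big)I_{\mu-1}\Big(2\mu\sqrt{\tfrac{\kappa(1+\kappa)}{\bar w}x}\Big),$$ and $$\varphi(r)=\frac{\pi\lambda_b r^2\delta}{e^{\mu\kappa}}\Big(\frac{\mu(1+\kappa)}{s\bar w}\Big)^{\delta}\sum_{n=0}^\infty\frac{(\mu\kappa)^n}{n!\,\Gamma(\mu+n)}\,G^{2,1}_{2,2}\!\left(\frac{\mu(1+\kappa)(\pi\lambda_b)^{1/\delta}r^{\tau}}{s\bar w}\,\Big|\,{1-\delta,\;1\atop 0,\;n+\mu-\delta}\right).$$ ($\eta$-$\mu$ fading) $\eta>0$, $h=\frac{2+\eta^{-1}+\eta}4$, $H=\frac{\eta^{-1}-\eta}4$, each $G_j$ has on $(0,\infty)$ the density $$\frac{2\sqrt\pi\,\mu^{\mu+\frac12}h^\mu}{\Gamma(\mu)H^{\mu-\frac12}\bar w^{\mu+\frac12}}x^{\mu-\frac12}\exp\Big(-\frac{2\mu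 hx}{\bar w}\Big)I_{\mu-\frac12}\Big(\frac{2\mu Hx}{\bar w}\Big)$$ (where $H^{-(\mu-\frac12)}I_{\mu-\frac12}(2\mu Hx/\bar w)$ is read as an even entire function of $H$, which covers $\eta\ge1$), and $$\varphi(r)=\frac{2\pi^{3/2}\lambda_b r^2\delta}{\Gamma(\mu)h^\mu}\Big(\frac{2\mu h}{s\bar w}\Big)^{\delta}\sum_{n=0}^\infty\frac{2^{-2n-2\mu}}{n!\,\Gamma(\mu+n+\frac12)}\Big(\frac Hh\Big)^{2n}G^{2,1}_{2,2}\!\left(\frac{2\mu h(\pi\lambda_b)^{1/\delta}r^{\tau}}{s\bar w}\,\Big|\,{1-\delta,\;1\atop 0,\;2n+2\mu-\delta}\right).$$ Then in either case $I_c<\infty$ almost surely; for every $r\ge R$ the integrals defining the Meijer functions converge absolutely, to values independent of $c$, and the series in $\varphi(r)$ converges; the function $(1-\varphi(r))r$ is integrable on $(R,\infty)$; and $$\mathbb E\big[e^{-sI_c}\big]=\exp\Big(-2\pi\lambda_b\int_R^\infty(1-\varphi(r))\,r\,dr\Big).$$ -/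

import Mathlib

open MeasureTheory ProbabilityTheory

noncomputable section

/-! ### Special functions -/

/-- The entire part of the modified Bessel function of the first kind,
`∑ₖ (z/2)^(2k) / (k! Γ(k+ν+1))`. -/
def besselISeries (nu z : ℝ) : ℝ :=
  ∑' k : ℕ, (z / 2) ^ (2 * k) / ((Nat.factorial k : ℝ) * Real.Gamma (k + nu + 1))

/-- Modified Bessel function of the first kind `I_ν(z)`, for `z > 0`. -/
def besselI (nu z : ℝ) : ℝ :=
  (z / 2) ^ nu * besselISeries nu z

/-- Integrand of the Mellin–Barnes integral of the Meijer function `G^{m,n}_{p,q}(z | a; b)`: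
`∏_{j≤m} Γ(b_j-u) ∏_{j≤n} Γ(1-a_j+u) / (∏_{j>m} Γ(1-b_j+u) ∏_{j>n} Γ(a_j-u)) · z^u`.
(The reciprocal of Mathlib's `Complex.Gamma` is `0` at the poles, as it should be.) -/
def meijerGIntegrand {p q : ℕ} (m n : ℕ) (a : Fin p → ℂ) (b : Fin q → ℂ) (z u : ℂ) : ℂ :=
  (∏ j : Fin q,
      if (j : ℕ) < m then Complex.Gamma (b j - u) else (Complex.Gamma (1 - b j + u))⁻¹) *
    (∏ j : Fin p,
      if (j : ℕ) < n then Complex.Gamma (1 - a j + u) else (Complex.Gamma (a j - u))⁻¹) *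
    z ^ u

/-- The vertical line `Re u = c` separates the poles of `Γ(b_j-u)`, `j ≤ m` (on its right) from
those of `Γ(1-a_j+u)`, `j ≤ n` (on its left). -/
def MeijerGSeparates {p q : ℕ} (m n : ℕ) (a : Fin p → ℂ) (b : Fin q → ℂ) (c : ℝ) : Prop :=
  (∀ j : Fin q, (j : ℕ) < m → c < (b j).re) ∧ (∀ j : Fin p, (j : ℕ) < n → (a j).re - 1 < c)

/-- The Mellin–Barnes integral `(2πi)⁻¹ ∫ … du` along the upward line `Re u = c`. -/
def meijerGLine {p q : ℕ} (m n : ℕ) (a : Fin p → ℂ) (b : Fin q → ℂ) (z : ℂ) (c : ℝ) : ℂ :=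
  (2 * (Real.pi : ℂ))⁻¹ * ∫ t : ℝ, meijerGIntegrand m n a b z ((c : ℂ) + (t : ℂ) * Complex.I)

open Classical in
/-- The Meijer function `G^{m,n}_{p,q}(z | a; b)` for parameters whose two families of poles can be
separated by a vertical line: the Mellin–Barnes integral along such a line. -/
def meijerG {p q : ℕ} (m n : ℕ) (a : Fin p → ℂ) (b : Fin q → ℂ) (z : ℂ) : ℂ :=
  if h : ∃ c : ℝ, MeijerGSeparates m n a b c then meijerGLine m n a b z h.choose else 0

/-- `meijerG m n a b z` is a genuine value: a separating line exists, and along every separating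
line the Mellin–Barnes integral converges absolutely, to this same value. -/
def MeijerGWellDefined {p q : ℕ} (m n : ℕ) (a : Fin p → ℂ) (b : Fin q → ℂ) (z : ℂ) : Prop :=
  (∃ c : ℝ, MeijerGSeparates m n a b c) ∧
    ∀ c : ℝ, MeijerGSeparates m n a b c →
      Integrable (fun t : ℝ => meijerGIntegrand m n a b z ((c : ℂ) + (t : ℂ) * Complex.I)) ∧
        meijerGLine m n a b z c = meijerG m n a b z

/-! ### Fading distributions -/

/-- Density of the `κ`-`μ` distribution with mean `w`. -/
def kappaMuPDF (kappa mu w x : ℝ) : ℝ :=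
  if 0 < x then
    mu / (kappa ^ ((mu - 1) / 2) * Real.exp (mu * kappa)) *
      ((1 + kappa) / w) ^ ((mu + 1) / 2) * x ^ ((mu - 1) / 2) *
      Real.exp (-(mu * (1 + kappa) / w * x)) *
      besselI (mu - 1) (2 * mu * Real.sqrt (kappa * (1 + kappa) / w * x))
  else 0

/-- The law of a `κ`-`μ` fading power coefficient. -/
def kappaMuLaw (kappa mu w : ℝ) : Measure ℝ :=
  volume.withDensity fun x => ENNReal.ofReal (kappaMuPDF kappa mu w x)

/-- `h = (2 + η⁻¹ + η)/4`. -/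
def etaMuh (eta : ℝ) : ℝ := (2 + eta⁻¹ + eta) / 4

/-- `H = (η⁻¹ - η)/4`. -/
def etaMuH (eta : ℝ) : ℝ := (eta⁻¹ - eta) / 4

/-- Density of the `η`-`μ` distribution with mean `w`. The usual expression contains
`H^{-(μ-1/2)} I_{μ-1/2}(2μHx/w)`, which is an even entire function of `H`; it is written here as
`(μx/w)^{μ-1/2}` times the entire part of the Bessel function, so that it is also meaningful for
`H = 0` (`η = 1`) and `H < 0` (`η > 1`). See `etaMuPDF_eq` for the usual form. -/
def etaMuPDF (eta mu w x : ℝ) : ℝ :=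
  if 0 < x then
    2 * Real.sqrt Real.pi * mu ^ (mu + 1 / 2) * etaMuh eta ^ mu /
        (Real.Gamma mu * w ^ (mu + 1 / 2)) *
      x ^ (mu - 1 / 2) * Real.exp (-(2 * mu * etaMuh eta * x / w)) *
      ((mu * x / w) ^ (mu - 1 / 2) * besselISeries (mu - 1 / 2) (2 * mu * etaMuH eta * x / w))
  else 0

theorem etaMuPDF_eq (eta mu w x : ℝ) (hH : 0 < etaMuH eta) (hmu : 0 < mu) (hw : 0 < w)
    (hx : 0 < x) :
    etaMuPDF eta mu w x =
      2 * Real.sqrt Real.pi * mu ^ (mu + 1 / 2) * etaMuh eta ^ mu /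
          (Real.Gamma mu * etaMuH eta ^ (mu - 1 / 2) * w ^ (mu + 1 / 2)) *
        x ^ (mu - 1 / 2) * Real.exp (-(2 * mu * etaMuh eta * x / w)) *
        besselI (mu - 1 / 2) (2 * mu * etaMuH eta * x / w) := by
  have e : 2 * mu * etaMuH eta * x / w / 2 = etaMuH eta * (mu * x / w) := by ring
  have hp : etaMuH eta ^ (mu - 1 / 2) ≠ 0 := (Real.rpow_pos_of_pos hH _).ne'
  have hG : Real.Gamma mu ≠ 0 := (Real.Gamma_pos_of_pos hmu).ne'
  have hwp : w ^ (mu + 1 / 2) ≠ 0 := (Real.rpow_pos_of_pos hw _).ne'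
  rw [etaMuPDF, if_pos hx, besselI, e, Real.mul_rpow hH.le (by positivity)]
  field_simp

/-- The law of an `η`-`μ` fading power coefficient. -/
def etaMuLaw (eta mu w : ℝ) : Measure ℝ :=
  volume.withDensity fun x => ENNReal.ofReal (etaMuPDF eta mu w x)

/-! ### The cellular uplink model -/

/-- The Euclidean plane. -/
abbrev Plane : Type := EuclideanSpace ℝ (Fin 2)

/-- Number of points of the point process `{X_j}` in `B`. -/
def pointCount {Ω : Type*} (X : ℕ → Ω → Plane) (B : Set Plane) (ω : Ω) : ℕ∞ :=
  {j : ℕ | X j ω ∈ B}.encard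

/-- On the region `D`, the point process `{X_j}` is a homogeneous Poisson point process of
intensity `lam`. Points of the sequence outside `D` are not constrained. -/
structure IsHomogeneousPPPOn {Ω : Type*} [MeasurableSpace Ω] (P : Measure Ω)
    (X : ℕ → Ω → Plane) (D : Set Plane) (lam : ℝ) : Prop where
  measurable : ∀ j, Measurable (X j)
  poisson : ∀ B : Set Plane, B ⊆ D → MeasurableSet B → volume B ≠ ⊤ → ∀ k : ℕ,
    P {ω | pointCount X B ω = k} =
      ENNReal.ofReal (Real.exp (-(lam * (volume B).toReal)) *
        (lam * (volume B).toReal) ^ k / (Nat.factorial k : ℝ))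
  indep : ∀ (N : ℕ) (B : Fin N → Set Plane), (∀ i, B i ⊆ D) → (∀ i, MeasurableSet (B i)) →
    Pairwise (fun i i' => Disjoint (B i) (B i')) →
    iIndepFun (fun i ω => pointCount X (B i) ω) P

/-- Radius `R = (π λ_b)^{-1/2}` of a cell. -/
def cellRadius (lamb : ℝ) : ℝ := Real.sqrt (1 / (Real.pi * lamb))

/-- The cell `𝒜 = B(0, R)`. -/
def cell (lamb : ℝ) : Set Plane := Metric.ball 0 (cellRadius lamb)

/-- Law of the length of a cellular link: density `2πλ_b x` on `[0, R]`. -/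
def cellularLinkLaw (lamb : ℝ) : Measure ℝ :=
  volume.withDensity
    ((Set.Icc 0 (cellRadius lamb)).indicator fun x => ENNReal.ofReal (2 * Real.pi * lamb * x))

/-- The interferers of a cellular uplink: outside the cell the positions `X_j` form a PPP of
intensity `λ_b`; the points carry independent marks `(L_j, G_j)` (independent of the positions,
i.i.d. over `j`), with link length `L_j` and fading coefficient `G_j` independent of each other,
`L_j` having the cellular link law and `G_j` the law `fading`. -/
structure IsUplinkModel {Ω : Type*} [MeasurableSpace Ω] (P : Measure Ω)
    (X : ℕ → Ω → Plane) (L G : ℕ → Ω → ℝ) (lamb : ℝ) (fading : Measure ℝ) : Prop where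
  ppp : IsHomogeneousPPPOn P X (cell lamb)ᶜ lamb
  measurable_link : ∀ j, Measurable (L j)
  measurable_fading : ∀ j, Measurable (G j)
  link_law : ∀ j, P.map (L j) = cellularLinkLaw lamb
  fading_law : ∀ j, P.map (G j) = fading
  link_indep_fading : ∀ j, IndepFun (L j) (G j) P
  marks_indep : iIndepFun (fun j ω => (L j ω, G j ω)) P
  marks_indep_points : IndepFun (fun ω j => X j ω) (fun ω j => (L j ω, G j ω)) P

/-- Contribution of the `j`-th point to the interference: `P_j G_j ‖X_j‖^{-τ}`, with transmit power
`P_j = L_j^τ` (channel inversion), if `X_j` is outside the cell, and `0` otherwise. -/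
def interferenceTerm {Ω : Type*} (X : ℕ → Ω → Plane) (L G : ℕ → Ω → ℝ) (lamb tau : ℝ)
    (j : ℕ) (ω : Ω) : ℝ :=
  (cell lamb)ᶜ.indicator (fun x => L j ω ^ tau * G j ω * ‖x‖ ^ (-tau)) (X j ω)

/-- The interference `I_c` at the base station located at the origin. -/
def interference {Ω : Type*} (X : ℕ → Ω → Plane) (L G : ℕ → Ω → ℝ) (lamb tau : ℝ) (ω : Ω) : ℝ :=
  ∑' j, interferenceTerm X L G lamb tau j ω

/-- Laplace transform `E[exp(-sY)]` of a random variable. -/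
def laplaceTransform {Ω : Type*} [MeasurableSpace Ω] (P : Measure Ω) (Y : Ω → ℝ) (s : ℝ) : ℝ :=
  ∫ ω, Real.exp (-(s * Y ω)) ∂P

/-! ### The function `φ` -/

/-- Upper parameters `1-δ, 1` of the Meijer functions. -/
def upperParams (delta : ℝ) : Fin 2 → ℂ := ![((1 - delta : ℝ) : ℂ), 1]

/-- Lower parameters `0, β-δ` of the Meijer functions. -/
def lowerParams (delta beta : ℝ) : Fin 2 → ℂ := ![0, ((beta - delta : ℝ) : ℂ)]

/-- Argument `μ(1+κ)(πλ_b)^{1/δ} r^τ / (s w)`, `δ = 2/τ`. -/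
def kappaMuArg (kappa mu w lamb tau s r : ℝ) : ℝ :=
  mu * (1 + kappa) * (Real.pi * lamb) ^ (1 / (2 / tau)) * r ^ tau / (s * w)

/-- `n`-th term of the series in `φ` for `κ`-`μ` fading. -/
def kappaMuTerm (kappa mu w lamb tau s r : ℝ) (n : ℕ) : ℂ :=
  (((mu * kappa) ^ n / ((Nat.factorial n : ℝ) * Real.Gamma (mu + n)) : ℝ) : ℂ) *
    meijerG 2 1 (upperParams (2 / tau)) (lowerParams (2 / tau) (n + mu))
      (kappaMuArg kappa mu w lamb tau s r : ℂ)

/-- `φ` for `κ`-`μ` fading. -/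
def phiKappaMu (kappa mu w lamb tau s r : ℝ) : ℂ :=
  ((Real.pi * lamb * r ^ 2 * (2 / tau) / Real.exp (mu * kappa) *
      (mu * (1 + kappa) / (s * w)) ^ (2 / tau) : ℝ) : ℂ) *
    ∑' n : ℕ, kappaMuTerm kappa mu w lamb tau s r n

/-- Argument `2μh(πλ_b)^{1/δ} r^τ / (s w)`, `δ = 2/τ`. -/
def etaMuArg (eta mu w lamb tau s r : ℝ) : ℝ :=
  2 * mu * etaMuh eta * (Real.pi * lamb) ^ (1 / (2 / tau)) * r ^ tau / (s * w)

/-- `n`-th term of the series in `φ` for `η`-`μ` fading. -/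
def etaMuTerm (eta mu w lamb tau s r : ℝ) (n : ℕ) : ℂ :=
  (((2 : ℝ) ^ (-2 * (n : ℝ) - 2 * mu) / ((Nat.factorial n : ℝ) * Real.Gamma (mu + n + 1 / 2)) *
      (etaMuH eta / etaMuh eta) ^ (2 * n) : ℝ) : ℂ) *
    meijerG 2 1 (upperParams (2 / tau)) (lowerParams (2 / tau) (2 * n + 2 * mu))
      (etaMuArg eta mu w lamb tau s r : ℂ)

/-- `φ` for `η`-`μ` fading. -/
def phiEtaMu (eta mu w lamb tau s r : ℝ) : ℂ :=
  ((2 * Real.pi ^ (3 / 2 : ℝ) * lamb * r ^ 2 * (2 / tau) /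
      (Real.Gamma mu * etaMuh eta ^ mu) *
      (2 * mu * etaMuh eta / (s * w)) ^ (2 / tau) : ℝ) : ℂ) *
    ∑' n : ℕ, etaMuTerm eta mu w lamb tau s r n

end

/-!
Proof. The marks `(L_j, G_j)` are independent of the points, so conditioning on the points and
using the Laplace functional `E[exp(-∑ g(X_j))] = exp(-λ ∫ (1 - e^{-g}))` of a Poisson process with
`e^{-g(x)} = E[exp(-s L^τ G ‖x‖^{-τ})]` gives the asserted exponential with
`E[exp(-s L^τ G r^{-τ})]` in place of `φ(r)`. Both fading laws are mixtures of Gamma laws of one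
common rate `θ`, so this expectation is a series of integrals
`∫_0^R 2πλ l (1 + s l^τ / (θ r^τ))^{-β} dl`, which the substitution `x = s l^τ / (θ r^τ)` turns
into incomplete beta integrals `∫_0^{1/z} x^{δ-1} (1 + x)^{-β} dx`. The latter are the Meijer
functions of the statement: `(1 + x)^{-β}` is the inverse Mellin transform of
`Γ(v) Γ(β - v) / Γ(β)`, and integrating `x^{δ-1-v}` over `(0, 1/z)` produces the missing factor
`z^{v-δ} / (δ - v)`.
-/

open Set Filter
open scoped ENNReal NNReal Topology

/-! ### Mellin–Barnes integrals -/

theorem integral_cpow_smul_mellinInv {E : Type*} [NormedAddCommGroup E] [NormedSpace ℂ E]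
    [CompleteSpace E] {G : ℂ → E} {σ y : ℝ} {d : ℂ} (hσ : σ < d.re) (hy : 0 < y)
    (hG : Complex.VerticalIntegrable G σ) :
    ∫ x in Ioc 0 y, (x : ℂ) ^ (d - 1) • mellinInv σ G x =
      (y : ℂ) ^ d • mellinInv σ (fun v => (d - v)⁻¹ • G v) y := by
  set v : ℝ → ℂ := fun t => σ + t * Complex.I with hv
  have hv_re : ∀ t, (v t).re = σ := fun t => by simp [hv]
  have hy0 : (y : ℂ) ≠ 0 := by exact_mod_cast hy.ne'
  have integral_power (t : ℝ) :
      ∫ x in Ioc 0 y, (x : ℂ) ^ (d - 1 - v t) = (y : ℂ) ^ (d - v t) * (d - v t)⁻¹ := by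
    have hre : -1 < (d - 1 - v t).re := by simp [hv_re]; linarith
    have hne : d - v t ≠ 0 := fun h =>
      hσ.ne' (by simpa [hv_re, sub_eq_zero] using congrArg Complex.re h)
    rw [← intervalIntegral.integral_of_le hy.le, integral_cpow (.inl hre),
      show d - 1 - v t + 1 = d - v t by ring, Complex.ofReal_zero, Complex.zero_cpow hne, sub_zero,
      div_eq_mul_inv]
  have hint : Integrable (fun p : ℝ × ℝ => (p.1 : ℂ) ^ (d - 1 - v p.2) • G (v p.2))
      ((volume.restrict (Ioc 0 y)).prod volume) := by
    have hpow : IntegrableOn (fun x : ℝ => x ^ (d.re - 1 - σ)) (Ioc 0 y) :=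
      (intervalIntegrable_iff_integrableOn_Ioc_of_le hy.le).1
        (intervalIntegral.intervalIntegrable_rpow' (by linarith))
    refine (hpow.mul_prod hG.norm).mono' ?_ ?_
    · exact (by fun_prop : Measurable fun p : ℝ × ℝ =>
        (p.1 : ℂ) ^ (d - 1 - v p.2)).aestronglyMeasurable.smul hG.aestronglyMeasurable.comp_snd
    · filter_upwards [Measure.quasiMeasurePreserving_fst.ae (ae_restrict_mem measurableSet_Ioc)]
        with p hp
      rw [norm_smul, Complex.norm_cpow_eq_rpow_re_of_pos hp.1]
      simp [hv]
  calc ∫ x in Ioc 0 y, (x : ℂ) ^ (d - 1) • mellinInv σ G x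
      = ∫ x in Ioc 0 y, (1 / (2 * Real.pi)) • ∫ t, (x : ℂ) ^ (d - 1 - v t) • G (v t) := by
        refine setIntegral_congr_fun measurableSet_Ioc fun x hx => ?_
        have hx0 : (x : ℂ) ≠ 0 := by exact_mod_cast hx.1.ne'
        simp only [mellinInv]
        rw [smul_comm, ← integral_smul ((x : ℂ) ^ (d - 1))]
        congr 1
        refine integral_congr_ae (.of_forall fun t => ?_)
        change _ • _ • _ = _ • _
        rw [smul_smul, ← Complex.cpow_add _ _ hx0, ← sub_eq_add_neg]
    _ = (1 / (2 * Real.pi)) • ∫ t, ∫ x in Ioc 0 y, (x : ℂ) ^ (d - 1 - v t) • G (v t) := by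
        rw [integral_smul, integral_integral_swap hint]
    _ = (y : ℂ) ^ d • mellinInv σ (fun v => (d - v)⁻¹ • G v) y := by
        simp_rw [integral_smul_const, integral_power, mellinInv]
        rw [smul_comm ((y : ℂ) ^ d), ← integral_smul ((y : ℂ) ^ d)]
        congr 1
        refine integral_congr_ae (.of_forall fun t => ?_)
        dsimp only
        rw [smul_smul, smul_smul, sub_eq_add_neg, Complex.cpow_add _ _ hy0]

theorem image_div_one_add_Ioi : (fun t : ℝ => t / (1 + t)) '' Ioi 0 = Ioo 0 1 := by
  ext x
  constructor
  · rintro ⟨t, ht : 0 < t, rfl⟩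
    exact ⟨by positivity, (div_lt_one (by positivity)).2 (by linarith)⟩
  · rintro ⟨h0, h1⟩
    have h1' : 0 < 1 - x := by linarith
    refine ⟨x / (1 - x), div_pos h0 h1', ?_⟩
    field_simp
    ring

theorem injOn_div_one_add : InjOn (fun t : ℝ => t / (1 + t)) (Ioi 0) := by
  intro x (hx : 0 < x) y (hy : 0 < y) h
  field_simp at h
  linarith

theorem hasDerivAt_div_one_add {t : ℝ} (ht : 1 + t ≠ 0) :
    HasDerivAt (fun t : ℝ => t / (1 + t)) (1 / (1 + t) ^ 2) t := by
  refine ((hasDerivAt_id t).div ((hasDerivAt_id t).const_add 1) ht).congr_deriv ?_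
  simp

theorem abs_deriv_smul_betaIntegrand_div_one_add (a b : ℂ) {t : ℝ} (ht : 0 < t) :
    |1 / (1 + t) ^ 2| •
        (((t / (1 + t) : ℝ) : ℂ) ^ (a - 1) * (1 - ((t / (1 + t) : ℝ) : ℂ)) ^ (b - a - 1)) =
      (t : ℂ) ^ (a - 1) • ((1 + t : ℝ) : ℂ) ^ (-b) := by
  have h1t : 0 < 1 + t := by linarith
  have hne : ((1 + t : ℝ) : ℂ) ≠ 0 := by exact_mod_cast h1t.ne'
  have hjac : ((|1 / (1 + t) ^ 2| : ℝ) : ℂ) = ((1 + t : ℝ) : ℂ) ^ (-2 : ℂ) := by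
    rw [abs_of_pos (by positivity), Complex.cpow_neg]
    norm_cast
    simp
  have hcompl : (1 : ℂ) - ((t / (1 + t) : ℝ) : ℂ) = (((1 + t)⁻¹ : ℝ) : ℂ) := by
    rw [← Complex.ofReal_one, ← Complex.ofReal_sub]
    congr 1
    field_simp
    ring
  have hinv (c : ℂ) : (((1 + t)⁻¹ : ℝ) : ℂ) ^ c = ((1 + t : ℝ) : ℂ) ^ (-c) := by
    rw [Complex.cpow_neg, Complex.ofReal_inv, Complex.inv_cpow]
    rw [Complex.arg_ofReal_of_nonneg h1t.le]
    exact Real.pi_pos.ne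
  rw [Complex.real_smul, hjac, hcompl, div_eq_mul_inv, Complex.ofReal_mul,
    Complex.mul_cpow_ofReal_nonneg ht.le (by positivity), hinv, hinv, smul_eq_mul,
    mul_assoc, mul_left_comm, ← Complex.cpow_add _ _ hne, ← Complex.cpow_add _ _ hne]
  congr 2
  ring

/-- Euler's beta integral after the substitution `x = t / (1 + t)`. -/
theorem hasMellin_one_add_cpow_neg {a b : ℂ} (ha : 0 < a.re) (hab : a.re < b.re) :
    HasMellin (fun t : ℝ => ((1 + t : ℝ) : ℂ) ^ (-b)) a
      (Complex.Gamma a * Complex.Gamma (b - a) / Complex.Gamma b) := by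
  have hba : 0 < (b - a).re := by simpa using hab
  have hderiv : ∀ t ∈ Ioi (0 : ℝ),
      HasDerivWithinAt (fun t : ℝ => t / (1 + t)) (1 / (1 + t) ^ 2) (Ioi 0) t :=
    fun t (ht : 0 < t) => (hasDerivAt_div_one_add (by positivity)).hasDerivWithinAt
  have hpull := fun t (ht : t ∈ Ioi (0 : ℝ)) => abs_deriv_smul_betaIntegrand_div_one_add a b ht
  constructor
  · have hconv := Complex.betaIntegral_convergent ha hba
    rw [intervalIntegrable_iff_integrableOn_Ioo_of_le zero_le_one, ← image_div_one_add_Ioi,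
      integrableOn_image_iff_integrableOn_abs_deriv_smul measurableSet_Ioi hderiv
        injOn_div_one_add] at hconv
    exact hconv.congr_fun hpull measurableSet_Ioi
  · have hGamma : Complex.Gamma b ≠ 0 := Complex.Gamma_ne_zero_of_re_pos (by linarith)
    rw [Complex.Gamma_mul_Gamma_eq_betaIntegral ha hba, add_sub_cancel,
      mul_div_cancel_left₀ _ hGamma, Complex.betaIntegral,
      intervalIntegral.integral_of_le zero_le_one, integral_Ioc_eq_integral_Ioo,
      ← image_div_one_add_Ioi, integral_image_eq_integral_abs_deriv_smul measurableSet_Ioi hderiv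
        injOn_div_one_add]
    exact (setIntegral_congr_fun measurableSet_Ioi hpull).symm

theorem norm_complexGamma_le {z : ℂ} (hz : 0 < z.re) :
    ‖Complex.Gamma z‖ ≤ Real.Gamma z.re := by
  rw [Complex.Gamma_eq_integral hz, Real.Gamma_eq_integral hz, Complex.GammaIntegral]
  refine (norm_integral_le_integral_norm _).trans_eq ?_
  refine setIntegral_congr_fun measurableSet_Ioi fun x (hx : 0 < x) => ?_
  simp [Complex.norm_cpow_eq_rpow_re_of_pos hx, Complex.norm_exp]

theorem norm_complexGamma_le_div_norm {z : ℂ} (hz : 0 < z.re) :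
    ‖Complex.Gamma z‖ ≤ Real.Gamma (z.re + 1) / ‖z‖ := by
  have hz0 : z ≠ 0 := by rintro rfl; simp at hz
  have h := norm_complexGamma_le (z := z + 1) (by simp; linarith)
  rw [Complex.Gamma_add_one z hz0, norm_mul] at h
  rw [le_div_iff₀' (norm_pos_iff.2 hz0)]
  simpa using h

theorem continuous_complexGamma_vertical {σ : ℝ} (hσ : 0 < σ) :
    Continuous fun t : ℝ => Complex.Gamma (σ + t * Complex.I) := by
  refine continuous_iff_continuousAt.2 fun t => ?_
  refine ContinuousAt.comp (g := Complex.Gamma) ?_ (by fun_prop)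
  refine (Complex.differentiableAt_Gamma _ fun m h => ?_).continuousAt
  have hre : σ = -(m : ℝ) := by simpa using congrArg Complex.re h
  linarith [m.cast_nonneg (α := ℝ)]

theorem integrable_inv_sq_add_sq {σ : ℝ} (hσ : σ ≠ 0) :
    Integrable fun t : ℝ => (σ ^ 2 + t ^ 2)⁻¹ := by
  refine ((integrable_inv_one_add_sq.comp_div hσ).const_mul (σ ^ 2)⁻¹).congr
    (.of_forall fun t => ?_)
  simp only [← mul_inv]
  congr 1
  field_simp

theorem memLp_two_complexGamma_vertical {σ : ℝ} (hσ : 0 < σ) :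
    MemLp (fun t : ℝ => Complex.Gamma (σ + t * Complex.I)) 2 := by
  have hmeas := (continuous_complexGamma_vertical hσ).aestronglyMeasurable (μ := volume)
  refine (memLp_two_iff_integrable_sq_norm hmeas).2 ?_
  refine ((integrable_inv_sq_add_sq hσ.ne').const_mul (Real.Gamma (σ + 1) ^ 2)).mono'
    (hmeas.norm.pow 2) (.of_forall fun t => ?_)
  have h := norm_complexGamma_le_div_norm (z := σ + t * Complex.I) (by simpa using hσ)
  rw [Real.norm_of_nonneg (by positivity)]
  calc ‖Complex.Gamma (σ + t * Complex.I)‖ ^ 2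
      ≤ (Real.Gamma (σ + 1) / ‖(σ + t * Complex.I : ℂ)‖) ^ 2 := by
        gcongr
        simpa using h
    _ = Real.Gamma (σ + 1) ^ 2 * (σ ^ 2 + t ^ 2)⁻¹ := by
        rw [div_pow, Complex.sq_norm, Complex.normSq_add_mul_I, div_eq_mul_inv]

theorem verticalIntegrable_Gamma_mul_Gamma_sub {b : ℂ} {σ : ℝ} (hσ : 0 < σ) (hσb : σ < b.re) :
    Complex.VerticalIntegrable (fun v => Complex.Gamma v * Complex.Gamma (b - v)) σ := by
  have hreflected : MemLp (fun t : ℝ => Complex.Gamma (b - (σ + t * Complex.I))) 2 := by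
    have h := (memLp_two_complexGamma_vertical (sub_pos.2 hσb)).comp_measurePreserving
      (volume.measurePreserving_sub_left b.im)
    refine h.ae_eq (.of_forall fun t => congrArg Complex.Gamma ?_)
    apply Complex.ext <;> simp
  exact (memLp_two_complexGamma_vertical hσ).integrable_mul hreflected

theorem mellinInv_Gamma_mul_Gamma_sub {b : ℂ} {σ x : ℝ} (hσ : 0 < σ) (hσb : σ < b.re)
    (hx : 0 < x) :
    mellinInv σ (fun v => Complex.Gamma v * Complex.Gamma (b - v)) x =
      Complex.Gamma b * ((1 + x : ℝ) : ℂ) ^ (-b) := by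
  have hGamma : Complex.Gamma b ≠ 0 := Complex.Gamma_ne_zero_of_re_pos (by linarith)
  set f : ℝ → ℂ := fun x => Complex.Gamma b • ((1 + x : ℝ) : ℂ) ^ (-b)
  have hmellin (v : ℂ) (hv : v.re = σ) :
      HasMellin f v (Complex.Gamma v * Complex.Gamma (b - v)) := by
    have h := hasMellin_one_add_cpow_neg (a := v) (b := b) (hv ▸ hσ) (hv ▸ hσb)
    have h' := hasMellin_const_smul h.1 (Complex.Gamma b)
    rwa [h.2, smul_eq_mul, mul_div_cancel₀ _ hGamma] at h'
  have hline (t : ℝ) := (hmellin (σ + t * Complex.I) (by simp)).2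
  have hcont : ContinuousAt f x := by
    have hslit : ((1 + x : ℝ) : ℂ) ∈ Complex.slitPlane := .inl (by simp; linarith)
    have hbase : ContinuousAt (fun x : ℝ => ((1 + x : ℝ) : ℂ)) x := by fun_prop
    exact (hbase.cpow continuousAt_const hslit).const_smul (Complex.Gamma b)
  rw [← smul_eq_mul]
  refine Eq.trans ?_ (mellinInv_mellin_eq σ f hx (hmellin σ (by simp)).1
    ((verticalIntegrable_Gamma_mul_Gamma_sub hσ hσb).congr
      (.of_forall fun t => (hline t).symm)) hcont)
  simp only [mellinInv, hline]

/-- The incomplete beta integral of the second kind, `∫₀ˣ t^(d-1) (1+t)^(-b) dt`; it evaluates the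
Meijer functions of the statement. -/
noncomputable def incompleteBeta (d b x : ℝ) : ℝ :=
  ∫ t in Ioc 0 x, t ^ (d - 1) * (1 + t) ^ (-b)

theorem meijerGSeparates_iff {d b c : ℝ} :
    MeijerGSeparates 2 1 (upperParams d) (lowerParams d b) c ↔ c < 0 ∧ c < b - d ∧ -d < c := by
  simp [MeijerGSeparates, upperParams, lowerParams, Fin.forall_fin_two, and_assoc]

theorem exists_meijerGSeparates {d b : ℝ} (hd : 0 < d) (hb : 0 < b) :
    ∃ c, MeijerGSeparates 2 1 (upperParams d) (lowerParams d b) c := by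
  obtain ⟨c, h1, h2⟩ := exists_between (show -d < min 0 (b - d) by simp [hd, hb])
  exact ⟨c, meijerGSeparates_iff.2 ⟨h2.trans_le (min_le_left _ _),
    h2.trans_le (min_le_right _ _), h1⟩⟩

theorem meijerGIntegrand_eq {d b : ℝ} {u : ℂ} (hu : u.re < 0) (z : ℂ) :
    meijerGIntegrand 2 1 (upperParams d) (lowerParams d b) z u =
      z ^ u * ((-u)⁻¹ * (Complex.Gamma (d + u) * Complex.Gamma (b - (d + u)))) := by
  have hu0 : u ≠ 0 := by rintro rfl; simp at hu
  have hGamma : Complex.Gamma (-u) ≠ 0 := Complex.Gamma_ne_zero_of_re_pos (by simpa using hu)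
  have hrec : Complex.Gamma (1 - u) = -u * Complex.Gamma (-u) := by
    rw [← Complex.Gamma_add_one (-u) (neg_ne_zero.2 hu0), neg_add_eq_sub]
  simp only [meijerGIntegrand, upperParams, lowerParams, Fin.prod_univ_two]
  simp only [Matrix.cons_val_zero, Matrix.cons_val_one, Fin.val_zero, Fin.val_one]
  norm_num
  rw [hrec, show (b : ℂ) - d - u = b - (d + u) by ring]
  field_simp

section MeijerLine

variable {d b z c : ℝ}

theorem integrable_meijerGIntegrand (hz : 0 < z)
    (hc : MeijerGSeparates 2 1 (upperParams d) (lowerParams d b) c) :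
    Integrable fun t : ℝ => meijerGIntegrand 2 1 (upperParams d) (lowerParams d b) (z : ℂ)
      ((c : ℂ) + (t : ℂ) * Complex.I) := by
  obtain ⟨hc0, hcb, hcd⟩ := meijerGSeparates_iff.1 hc
  have hzC : (z : ℂ) ≠ 0 := by exact_mod_cast hz.ne'
  have hre (t : ℝ) : ((c : ℂ) + t * Complex.I).re = c := by simp
  have hne (t : ℝ) : -((c : ℂ) + t * Complex.I) ≠ 0 := fun h => by
    simpa [hc0.ne] using congrArg Complex.re h
  have hgamma : Integrable fun t : ℝ => Complex.Gamma (d + (c + t * Complex.I)) *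
      Complex.Gamma (b - (d + (c + t * Complex.I))) := by
    simpa [Complex.VerticalIntegrable, add_assoc] using
      verticalIntegrable_Gamma_mul_Gamma_sub (b := b) (σ := d + c) (by linarith)
        (by simp; linarith)
  have hinv : Continuous fun t : ℝ => (-((c : ℂ) + t * Complex.I))⁻¹ :=
    (by fun_prop : Continuous fun t : ℝ => -((c : ℂ) + t * Complex.I)).inv₀ hne
  have hpow : Continuous fun t : ℝ => (z : ℂ) ^ ((c : ℂ) + t * Complex.I) :=
    (by fun_prop : Continuous fun t : ℝ => (c : ℂ) + t * Complex.I).const_cpow (.inl hzC)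
  simp_rw [fun t => meijerGIntegrand_eq (d := d) (b := b) (by rw [hre t]; exact hc0) (z : ℂ)]
  refine (hgamma.bdd_mul (c := |c|⁻¹) hinv.aestronglyMeasurable (.of_forall fun t => ?_)).bdd_mul
    (c := z ^ c) hpow.aestronglyMeasurable (.of_forall fun t => ?_)
  · rw [norm_inv, norm_neg]
    refine inv_anti₀ (abs_pos.2 hc0.ne) ?_
    simpa [hre] using Complex.abs_re_le_norm ((c : ℂ) + t * Complex.I)
  · rw [Complex.norm_cpow_eq_rpow_re_of_pos hz, hre]

theorem meijerGLine_eq_cpow_mul_mellinInv (hz : 0 < z) (hc0 : c < 0) :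
    meijerGLine 2 1 (upperParams d) (lowerParams d b) (z : ℂ) c =
      ((z⁻¹ : ℝ) : ℂ) ^ (d : ℂ) * mellinInv (d + c)
        (fun v => (d - v)⁻¹ • (Complex.Gamma v * Complex.Gamma (b - v))) z⁻¹ := by
  have hz0 : ((z⁻¹ : ℝ) : ℂ) ≠ 0 := by exact_mod_cast (inv_pos.2 hz).ne'
  have hpow (u : ℂ) : (z : ℂ) ^ u = ((z⁻¹ : ℝ) : ℂ) ^ (-u) := by
    rw [Complex.ofReal_inv, Complex.inv_cpow, Complex.cpow_neg, inv_inv]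
    rw [Complex.arg_ofReal_of_nonneg hz.le]
    exact Real.pi_pos.ne
  rw [meijerGLine, mellinInv, Complex.real_smul, mul_left_comm,
    ← integral_const_mul (((z⁻¹ : ℝ) : ℂ) ^ (d : ℂ))]
  congr 1
  · push_cast
    ring
  · congr 1 with t
    rw [meijerGIntegrand_eq (by simpa using hc0), hpow, smul_eq_mul, smul_eq_mul, ← mul_assoc,
      ← mul_assoc, ← mul_assoc, ← Complex.cpow_add _ _ hz0, Complex.ofReal_add]
    ring_nf

theorem meijerGLine_eq (hz : 0 < z)
    (hc : MeijerGSeparates 2 1 (upperParams d) (lowerParams d b) c) :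
    meijerGLine 2 1 (upperParams d) (lowerParams d b) (z : ℂ) c =
      ((Real.Gamma b * incompleteBeta d b z⁻¹ : ℝ) : ℂ) := by
  obtain ⟨hc0, hcb, hcd⟩ := meijerGSeparates_iff.1 hc
  have hσ : 0 < d + c := by linarith
  have hσb : d + c < (b : ℂ).re := by simp; linarith
  rw [meijerGLine_eq_cpow_mul_mellinInv hz hc0, ← smul_eq_mul,
    ← integral_cpow_smul_mellinInv (by simpa using hc0) (inv_pos.2 hz)
      (verticalIntegrable_Gamma_mul_Gamma_sub hσ hσb),
    incompleteBeta, ← integral_const_mul, ← integral_complex_ofReal]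
  refine setIntegral_congr_fun measurableSet_Ioc fun x ⟨hx, _⟩ => ?_
  simp only [mellinInv_Gamma_mul_Gamma_sub hσ hσb hx, Complex.Gamma_ofReal, smul_eq_mul]
  rw [Complex.ofReal_mul, Complex.ofReal_mul, Complex.ofReal_cpow hx.le,
    Complex.ofReal_cpow (by linarith)]
  push_cast
  ring

theorem meijerG_eq (hd : 0 < d) (hb : 0 < b) (hz : 0 < z) :
    meijerG 2 1 (upperParams d) (lowerParams d b) (z : ℂ) =
      ((Real.Gamma b * incompleteBeta d b z⁻¹ : ℝ) : ℂ) := by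
  have h := exists_meijerGSeparates hd hb
  rw [meijerG, dif_pos h]
  exact meijerGLine_eq hz h.choose_spec

theorem meijerGWellDefined (hd : 0 < d) (hb : 0 < b) (hz : 0 < z) :
    MeijerGWellDefined 2 1 (upperParams d) (lowerParams d b) (z : ℂ) :=
  ⟨exists_meijerGSeparates hd hb, fun _ hc => ⟨integrable_meijerGIntegrand hz hc,
    (meijerGLine_eq hz hc).trans (meijerG_eq hd hb hz).symm⟩⟩

end MeijerLine

/-! ### The Laplace functional of a Poisson process -/

/-- The function `x ↦ e⁻ˣ` on `[0, ∞]`, with value `0` at `∞`: Laplace transforms of sums of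
nonnegative variables are formed with it before these sums are known to be finite. -/
noncomputable def expNeg (x : ℝ≥0∞) : ℝ≥0∞ := EReal.exp (-(x : EReal))

theorem expNeg_zero : expNeg 0 = 1 := by simp [expNeg]

theorem expNeg_ofReal {x : ℝ} (hx : 0 ≤ x) :
    expNeg (ENNReal.ofReal x) = ENNReal.ofReal (Real.exp (-x)) := by
  rw [expNeg, EReal.coe_ennreal_ofReal, max_eq_left hx, ← EReal.coe_neg, EReal.exp_coe]

theorem expNeg_add (x y : ℝ≥0∞) : expNeg (x + y) = expNeg x * expNeg y := by
  simp only [expNeg, EReal.exp_neg, EReal.coe_ennreal_add, EReal.exp_add]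
  refine ENNReal.mul_inv (.inl ?_) (.inr ?_) <;> simp [EReal.exp_eq_zero_iff]

theorem expNeg_sum {ι : Type*} (s : Finset ι) (f : ι → ℝ≥0∞) :
    expNeg (∑ i ∈ s, f i) = ∏ i ∈ s, expNeg (f i) := by
  induction s using Finset.cons_induction with
  | empty => simp [expNeg_zero]
  | cons i s hi ih => rw [Finset.sum_cons, Finset.prod_cons, expNeg_add, ih]

theorem expNeg_mul_natCast (x : ℝ≥0∞) (k : ℕ) : expNeg (x * k) = expNeg x ^ k := by
  simpa [mul_comm] using expNeg_sum (Finset.range k) fun _ => x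

theorem continuous_expNeg : Continuous expNeg :=
  ENNReal.continuous_exp.comp (continuous_neg.comp continuous_coe_ennreal_ereal)

@[fun_prop]
theorem measurable_expNeg : Measurable expNeg := continuous_expNeg.measurable

theorem antitone_expNeg : Antitone expNeg := fun _ _ h =>
  EReal.exp_monotone (EReal.neg_le_neg_iff.2 (by exact_mod_cast h))

theorem expNeg_le_one (x : ℝ≥0∞) : expNeg x ≤ 1 :=
  (antitone_expNeg zero_le).trans_eq expNeg_zero

theorem lintegral_pow_poissonMeasure (m : ℝ≥0) {q : ℝ≥0∞} (hq : q ≤ 1) :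
    ∫⁻ k, q ^ k ∂poissonMeasure m = expNeg (m * (1 - q)) := by
  lift q to ℝ≥0 using (hq.trans_lt ENNReal.one_lt_top).ne
  have hq1 : (q : ℝ) ≤ 1 := by exact_mod_cast hq
  have hterm (k : ℕ) : (q : ℝ≥0∞) ^ k * poissonMeasure m {k} =
      ENNReal.ofReal (Real.exp (-m) * (((m : ℝ) * q) ^ k / k.factorial)) := by
    rw [poissonMeasure_singleton, ← ENNReal.ofReal_coe_nnreal (p := q),
      ← ENNReal.ofReal_pow q.coe_nonneg, ← ENNReal.ofReal_mul (pow_nonneg q.coe_nonneg k), mul_pow]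
    congr 1
    ring
  have hexp : HasSum (fun k : ℕ => ((m : ℝ) * q) ^ k / k.factorial) (Real.exp (m * q)) := by
    rw [Real.exp_eq_exp_ℝ]
    exact NormedSpace.expSeries_div_hasSum_exp _
  rw [lintegral_countable', tsum_congr hterm,
    ← ENNReal.ofReal_tsum_of_nonneg (fun k => by positivity) (hexp.mul_left _).summable,
    (hexp.mul_left _).tsum_eq, ← Real.exp_add,
    show -(m : ℝ) + m * q = -(m * (1 - q)) by ring,
    ← expNeg_ofReal (mul_nonneg m.coe_nonneg (sub_nonneg.2 hq1)),
    ENNReal.ofReal_mul m.coe_nonneg, ENNReal.ofReal_sub _ q.coe_nonneg, ENNReal.ofReal_one,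
    ENNReal.ofReal_coe_nnreal, ENNReal.ofReal_coe_nnreal]

theorem lintegral_natCast_poissonMeasure (m : ℝ≥0) :
    ∫⁻ k, (k : ℝ≥0∞) ∂poissonMeasure m = m := by
  have hterm (k : ℕ) : ((k + 1 : ℕ) : ℝ≥0∞) * poissonMeasure m {k + 1} =
      m * poissonMeasure m {k} := by
    rw [poissonMeasure_singleton, poissonMeasure_singleton, ← ENNReal.ofReal_natCast,
      ← ENNReal.ofReal_coe_nnreal, ← ENNReal.ofReal_mul (by positivity),
      ← ENNReal.ofReal_mul m.coe_nonneg, Nat.factorial_succ]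
    congr 1
    push_cast
    field_simp
    ring
  have hone : ∑' k, poissonMeasure m {k} = 1 := by
    simpa using (lintegral_countable' (μ := poissonMeasure m) fun _ => 1).symm
  rw [lintegral_countable', tsum_eq_zero_add' ENNReal.summable, tsum_congr hterm,
    ENNReal.tsum_mul_left, hone]
  simp

theorem tendsto_tsum_of_monotone {ι : Type*} {f : ℕ → ι → ℝ≥0∞} {F : ι → ℝ≥0∞}
    (hf : ∀ i, Monotone fun n => f n i) (hlim : ∀ i, Tendsto (fun n => f n i) atTop (𝓝 (F i))) :
    Tendsto (fun n => ∑' i, f n i) atTop (𝓝 (∑' i, F i)) := by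
  let _ : MeasurableSpace ι := ⊤
  simp_rw [← lintegral_count]
  exact lintegral_tendsto_of_tendsto_of_monotone (fun n => measurable_from_top.aemeasurable)
    (.of_forall hf) (.of_forall hlim)

theorem tsum_indicator_eq_pointCount {Ω : Type*} (X : ℕ → Ω → Plane) (B : Set Plane) (ω : Ω) :
    ∑' j, B.indicator (fun _ => (1 : ℝ≥0∞)) (X j ω) = (pointCount X B ω : ℝ≥0∞) := by
  rw [pointCount, ← ENNReal.tsum_set_one, tsum_subtype _ fun _ => (1 : ℝ≥0∞)]
  rfl

theorem measurable_pointCount {Ω : Type*} [MeasurableSpace Ω] {X : ℕ → Ω → Plane}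
    (hX : ∀ j, Measurable (X j)) {B : Set Plane} (hB : MeasurableSet B) :
    Measurable (pointCount X B) := by
  have h : Measurable fun ω => (pointCount X B ω : ℝ≥0∞) := by
    simp_rw [← tsum_indicator_eq_pointCount]
    exact .tsum fun j => (measurable_const.indicator hB).comp (hX j)
  refine measurable_to_countable' fun k => ?_
  have hpre : pointCount X B ⁻¹' {k} = (fun ω => (pointCount X B ω : ℝ≥0∞)) ⁻¹' {(k : ℝ≥0∞)} := by
    ext ω
    simp
  rw [hpre]
  exact h (measurableSet_singleton _)

theorem measurableEmbedding_natCast_enat : MeasurableEmbedding (Nat.cast : ℕ → ℕ∞) where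
  injective := Nat.cast_injective
  measurable := measurable_from_top
  measurableSet_image' _ _ := (Set.to_countable _).measurableSet

theorem simpleFunc_apply_eq_sum {α : Type*} [MeasurableSpace α] (g : SimpleFunc α ℝ≥0∞) (x : α) :
    g x = ∑ y : {y // y ∈ g.range.filter (· ≠ 0)},
      (y : ℝ≥0∞) * (g ⁻¹' {(y : ℝ≥0∞)}).indicator (fun _ => 1) x := by
  classical
  rw [Finset.sum_coe_sort (g.range.filter (· ≠ 0))
      fun y => y * (g ⁻¹' {y}).indicator (fun _ => 1) x,
    Finset.sum_filter_of_ne fun y _ hy => left_ne_zero_of_mul hy]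
  simp only [indicator_apply, mem_preimage, mem_singleton_iff, mul_ite, mul_one, mul_zero]
  rw [Finset.sum_ite_eq, if_pos (g.mem_range_self x)]

theorem exists_simpleFunc_finMeasSupp_tendsto {α : Type*} [MeasurableSpace α] (μ : Measure α)
    [SigmaFinite μ] {f : α → ℝ≥0∞} (hf : Measurable f) :
    ∃ g : ℕ → SimpleFunc α ℝ≥0∞, (∀ n, (g n).FinMeasSupp μ) ∧ (∀ n x, g n x ≤ f x) ∧
      (∀ x, Monotone fun n => g n x) ∧ ∀ x, Tendsto (fun n => g n x) atTop (𝓝 (f x)) := by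
  set g : ℕ → SimpleFunc α ℝ≥0∞ := fun n =>
    (SimpleFunc.eapprox f n).restrict (spanningSets μ n)
  have hg (n : ℕ) (x : α) : g n x = (spanningSets μ n).indicator (SimpleFunc.eapprox f n) x :=
    SimpleFunc.restrict_apply _ (measurableSet_spanningSets μ n) x
  refine ⟨g, fun n => ?_, fun n x => ?_, fun x m n hmn => ?_, fun x => ?_⟩
  · refine SimpleFunc.finMeasSupp_iff_support.2
      ((measure_mono fun x hx => ?_).trans_lt (measure_spanningSets_lt_top μ n))
    by_contra hxn
    exact hx (by rw [hg, indicator_of_notMem hxn])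
  · rw [hg, ← SimpleFunc.iSup_eapprox_apply hf x]
    exact (indicator_le_self _ _ x).trans (le_iSup (fun n => SimpleFunc.eapprox f n x) n)
  · simp only [hg]
    exact (indicator_le_indicator (SimpleFunc.monotone_eapprox f hmn x)).trans
      (indicator_le_indicator_of_subset (monotone_spanningSets μ hmn) (fun _ => zero_le) x)
  · refine (SimpleFunc.tendsto_eapprox hf x).congr' ?_
    filter_upwards [eventually_mem_spanningSets μ x] with n hn
    rw [hg, indicator_of_mem hn]

namespace IsHomogeneousPPPOn

variable {Ω : Type*} [MeasurableSpace Ω] {P : Measure Ω} {X : ℕ → Ω → Plane} {D : Set Plane}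
  {lam : ℝ}

theorem iIndepFun_pointCount (h : IsHomogeneousPPPOn P X D lam) {ι : Type*} [Finite ι]
    {B : ι → Set Plane} (hBD : ∀ i, B i ⊆ D) (hB : ∀ i, MeasurableSet (B i))
    (hdisj : Pairwise (Function.onFun Disjoint B)) :
    iIndepFun (fun i => pointCount X (B i)) P := by
  obtain ⟨n, ⟨e⟩⟩ := Finite.exists_equiv_fin ι
  have hind := h.indep n (fun k => B (e.symm k)) (fun k => hBD _) (fun k => hB _)
    fun k l hkl => hdisj (e.symm.injective.ne hkl)
  simpa using hind.precomp e.injective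

variable [IsProbabilityMeasure P]

theorem map_pointCount (h : IsHomogeneousPPPOn P X D lam) (hlam : 0 ≤ lam) {B : Set Plane}
    (hBD : B ⊆ D) (hB : MeasurableSet B) (hBv : volume B ≠ ∞) :
    P.map (pointCount X B) =
      (poissonMeasure (ENNReal.ofReal lam * volume B).toNNReal).map (Nat.cast : ℕ → ℕ∞) := by
  have hN := measurable_pointCount h.measurable hB
  have hcomap : (P.map (pointCount X B)).comap (Nat.cast : ℕ → ℕ∞) =
      poissonMeasure (ENNReal.ofReal lam * volume B).toNNReal := by
    refine Measure.ext_of_singleton fun k => ?_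
    rw [measurableEmbedding_natCast_enat.comap_apply, image_singleton,
      Measure.map_apply hN (measurableSet_singleton _), poissonMeasure_singleton]
    refine (h.poisson B hBD hB hBv k).trans ?_
    simp [ENNReal.coe_toNNReal_eq_toReal, ENNReal.toReal_ofReal hlam]
  have : IsProbabilityMeasure (P.map (pointCount X B)) :=
    Measure.isProbabilityMeasure_map hN.aemeasurable
  refine (Measure.eq_of_le_of_isProbabilityMeasure ?_).symm
  rw [← hcomap, measurableEmbedding_natCast_enat.map_comap]
  exact Measure.restrict_le_self

theorem lintegral_pointCount (h : IsHomogeneousPPPOn P X D lam) (hlam : 0 ≤ lam) {B : Set Plane}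
    (hBD : B ⊆ D) (hB : MeasurableSet B) (hBv : volume B ≠ ∞) (F : ℕ∞ → ℝ≥0∞) :
    ∫⁻ ω, F (pointCount X B ω) ∂P =
      ∫⁻ k, F k ∂poissonMeasure (ENNReal.ofReal lam * volume B).toNNReal := by
  rw [← lintegral_map measurable_from_top (measurable_pointCount h.measurable hB),
    h.map_pointCount hlam hBD hB hBv, lintegral_map measurable_from_top measurable_from_top]

theorem lintegral_expNeg_mul_pointCount (h : IsHomogeneousPPPOn P X D lam) (hlam : 0 ≤ lam)
    {B : Set Plane} (hBD : B ⊆ D) (hB : MeasurableSet B) (hBv : volume B ≠ ∞) (a : ℝ≥0∞) :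
    ∫⁻ ω, expNeg (a * (pointCount X B ω : ℝ≥0∞)) ∂P =
      expNeg (ENNReal.ofReal lam * ((1 - expNeg a) * volume B)) := by
  rw [h.lintegral_pointCount hlam hBD hB hBv fun k => expNeg (a * (k : ℝ≥0∞))]
  simp only [ENat.toENNReal_coe, expNeg_mul_natCast]
  rw [lintegral_pow_poissonMeasure _ (expNeg_le_one a),
    ENNReal.coe_toNNReal (ENNReal.mul_ne_top ENNReal.ofReal_ne_top hBv), mul_assoc,
    mul_comm (volume B)]

theorem lintegral_expNeg_sum_mul_pointCount (h : IsHomogeneousPPPOn P X D lam) (hlam : 0 ≤ lam)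
    {ι : Type*} [Fintype ι] {B : ι → Set Plane} (hBD : ∀ i, B i ⊆ D)
    (hB : ∀ i, MeasurableSet (B i)) (hdisj : Pairwise (Function.onFun Disjoint B))
    (hBv : ∀ i, volume (B i) ≠ ∞) (a : ι → ℝ≥0∞) :
    ∫⁻ ω, expNeg (∑ i, a i * (pointCount X (B i) ω : ℝ≥0∞)) ∂P =
      expNeg (ENNReal.ofReal lam * ∑ i, (1 - expNeg (a i)) * volume (B i)) := by
  have hind := (h.iIndepFun_pointCount hBD hB hdisj).comp
    (fun i k => expNeg (a i * (k : ℝ≥0∞))) fun _ => measurable_from_top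
  simp_rw [expNeg_sum, Finset.mul_sum, expNeg_sum]
  refine (lintegral_prod_eq_prod_lintegral_of_indepFun Finset.univ _ hind fun i =>
    measurable_from_top.comp (measurable_pointCount h.measurable (hB i))).trans ?_
  exact Finset.prod_congr rfl fun i _ =>
    h.lintegral_expNeg_mul_pointCount hlam (hBD i) (hB i) (hBv i) (a i)

theorem lintegral_expNeg_tsum_simpleFunc (h : IsHomogeneousPPPOn P X D lam) (hlam : 0 ≤ lam)
    (g : SimpleFunc Plane ℝ≥0∞) (hgD : ∀ x, x ∉ D → g x = 0) (hg : g.FinMeasSupp volume) :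
    ∫⁻ ω, expNeg (∑' j, g (X j ω)) ∂P =
      expNeg (ENNReal.ofReal lam * ∫⁻ x, (1 - expNeg (g x))) := by
  have hne (y : {y // y ∈ g.range.filter (· ≠ 0)}) : (y : ℝ≥0∞) ≠ 0 :=
    (Finset.mem_filter.1 y.2).2
  have hsum (ω : Ω) : ∑' j, g (X j ω) = ∑ y : {y // y ∈ g.range.filter (· ≠ 0)},
      (y : ℝ≥0∞) * (pointCount X (g ⁻¹' {(y : ℝ≥0∞)}) ω : ℝ≥0∞) := by
    simp_rw [fun j => simpleFunc_apply_eq_sum g (X j ω)]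
    rw [Summable.tsum_finsetSum fun _ _ => ENNReal.summable]
    simp_rw [ENNReal.tsum_mul_left, tsum_indicator_eq_pointCount]
  have hint : ∫⁻ x, (1 - expNeg (g x)) = ∑ y : {y // y ∈ g.range.filter (· ≠ 0)},
      (1 - expNeg y) * volume (g ⁻¹' {(y : ℝ≥0∞)}) := by
    rw [Finset.sum_coe_sort (g.range.filter (· ≠ 0))
        fun y => (1 - expNeg y) * volume (g ⁻¹' {y}),
      Finset.sum_filter_of_ne, ← SimpleFunc.map_lintegral, ← SimpleFunc.lintegral_eq_lintegral]
    · rfl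
    · rintro y - hy rfl
      simp [expNeg_zero] at hy
  simp_rw [hsum]
  rw [hint]
  refine h.lintegral_expNeg_sum_mul_pointCount hlam (fun y x hx => ?_)
    (fun y => g.measurableSet_fiber _) (fun y z hyz => disjoint_left.2 fun x hy hz => ?_)
    (fun y => (hg.meas_preimage_singleton_ne_zero (hne y)).ne) fun y => y
  · by_contra hxD
    exact hne y ((mem_singleton_iff.1 hx).symm.trans (hgD x hxD))
  · exact hyz (Subtype.ext ((mem_singleton_iff.1 hy).symm.trans (mem_singleton_iff.1 hz)))

theorem lintegral_expNeg_tsum (h : IsHomogeneousPPPOn P X D lam) (hlam : 0 ≤ lam)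
    {f : Plane → ℝ≥0∞} (hf : Measurable f) (hfD : ∀ x, x ∉ D → f x = 0) :
    ∫⁻ ω, expNeg (∑' j, f (X j ω)) ∂P =
      expNeg (ENNReal.ofReal lam * ∫⁻ x, (1 - expNeg (f x))) := by
  obtain ⟨g, hfin, hle, hmono, hlim⟩ := exists_simpleFunc_finMeasSupp_tendsto volume hf
  have hsimple (n : ℕ) := h.lintegral_expNeg_tsum_simpleFunc hlam (g n)
    (fun x hx => le_antisymm ((hle n x).trans_eq (hfD x hx)) zero_le) (hfin n)
  have hleft : Tendsto (fun n => ∫⁻ ω, expNeg (∑' j, g n (X j ω)) ∂P) atTop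
      (𝓝 (∫⁻ ω, expNeg (∑' j, f (X j ω)) ∂P)) := by
    refine tendsto_lintegral_of_dominated_convergence (fun _ => 1) (fun n => ?_)
      (fun n => .of_forall fun ω => expNeg_le_one _) (by simp) (.of_forall fun ω => ?_)
    · exact measurable_expNeg.comp (.tsum fun j => (g n).measurable.comp (h.measurable j))
    · exact (continuous_expNeg.tendsto _).comp
        (tendsto_tsum_of_monotone (fun _ => hmono _) fun _ => hlim _)
  have hright : Tendsto (fun n => expNeg (ENNReal.ofReal lam * ∫⁻ x, (1 - expNeg (g n x)))) atTop
      (𝓝 (expNeg (ENNReal.ofReal lam * ∫⁻ x, (1 - expNeg (f x))))) := by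
    refine (continuous_expNeg.tendsto _).comp
      (ENNReal.Tendsto.const_mul ?_ (.inr ENNReal.ofReal_ne_top))
    refine lintegral_tendsto_of_tendsto_of_monotone (fun n => ?_) (.of_forall fun x => ?_)
      (.of_forall fun x => ?_)
    · exact (measurable_const.sub (measurable_expNeg.comp (g n).measurable)).aemeasurable
    · exact fun m n hmn => tsub_le_tsub_left (antitone_expNeg (hmono x hmn)) 1
    · exact ENNReal.Tendsto.sub tendsto_const_nhds ((continuous_expNeg.tendsto _).comp (hlim x))
        (.inl ENNReal.one_ne_top)
  exact tendsto_nhds_unique hleft (by simpa only [hsimple] using hright)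

theorem tsum_map_apply (h : IsHomogeneousPPPOn P X D lam) (hlam : 0 ≤ lam) {B : Set Plane}
    (hBD : B ⊆ D) (hB : MeasurableSet B) (hBv : volume B ≠ ∞) :
    ∑' j, P.map (X j) B = ENNReal.ofReal lam * volume B := by
  have hindicator (j : ℕ) :
      P.map (X j) B = ∫⁻ ω, B.indicator (fun _ => (1 : ℝ≥0∞)) (X j ω) ∂P := by
    rw [← lintegral_map (measurable_const.indicator hB) (h.measurable j)]
    exact (lintegral_indicator_one hB).symm
  have hcount := h.lintegral_pointCount hlam hBD hB hBv fun k => (k : ℝ≥0∞)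
  simp only [ENat.toENNReal_coe, lintegral_natCast_poissonMeasure] at hcount
  rw [ENNReal.coe_toNNReal (ENNReal.mul_ne_top ENNReal.ofReal_ne_top hBv)] at hcount
  simp_rw [hindicator, ← hcount, ← tsum_indicator_eq_pointCount]
  exact (lintegral_tsum fun j =>
    ((measurable_const.indicator hB).comp (h.measurable j)).aemeasurable).symm

theorem restrict_sum_map (h : IsHomogeneousPPPOn P X D lam) (hlam : 0 ≤ lam)
    (hD : MeasurableSet D) :
    (Measure.sum fun j => P.map (X j)).restrict D = (ENNReal.ofReal lam • volume).restrict D := by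
  refine (Measure.ext_iff_of_iUnion_eq_univ (iUnion_spanningSets volume)).2 fun n =>
    Measure.ext fun B hB => ?_
  have hBn := hB.inter (measurableSet_spanningSets (volume : Measure Plane) n)
  rw [Measure.restrict_apply hB, Measure.restrict_apply hB, Measure.restrict_apply hBn,
    Measure.restrict_apply hBn, Measure.sum_apply _ (hBn.inter hD), Measure.smul_apply,
    smul_eq_mul]
  refine h.tsum_map_apply hlam inter_subset_right (hBn.inter hD) ?_
  exact ((measure_mono (inter_subset_left.trans inter_subset_right)).trans_lt
    (measure_spanningSets_lt_top volume n)).ne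

theorem tsum_lintegral (h : IsHomogeneousPPPOn P X D lam) (hlam : 0 ≤ lam) (hD : MeasurableSet D)
    {f : Plane → ℝ≥0∞} (hf : Measurable f) (hfD : ∀ x, x ∉ D → f x = 0) :
    ∑' j, ∫⁻ ω, f (X j ω) ∂P = ENNReal.ofReal lam * ∫⁻ x, f x := by
  have hrestrict (ν : Measure Plane) : ∫⁻ x, f x ∂(ν.restrict D) = ∫⁻ x, f x ∂ν := by
    refine setLIntegral_eq_of_support_subset ?_
    exact fun x hx => by_contra fun hxD => hx (hfD x hxD)
  simp_rw [← lintegral_map hf (h.measurable _)]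
  rw [← lintegral_sum_measure, ← hrestrict, h.restrict_sum_map hlam hD, hrestrict,
    lintegral_smul_measure, smul_eq_mul]

end IsHomogeneousPPPOn

/-! ### Gamma distributions and their mixtures -/

theorem gammaPDFReal_of_pos {a r x : ℝ} (hr : 0 < r) (hx : 0 < x) :
    gammaPDFReal a r x = (r * x) ^ a / (Real.Gamma a * x) * Real.exp (-(r * x)) := by
  rw [gammaPDFReal, if_pos hx.le, Real.mul_rpow hr.le hx.le, Real.rpow_sub_one hx.ne']
  ring

theorem gammaPDFReal_mul_exp {a r q : ℝ} (hr : 0 < r) (hq : 0 < r + q) (x : ℝ) :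
    gammaPDFReal a r x * Real.exp (-(q * x)) =
      (1 + q / r) ^ (-a) * gammaPDFReal a (r + q) x := by
  unfold gammaPDFReal
  split_ifs
  · have hpow : (1 + q / r) ^ (-a) * (r + q) ^ a = r ^ a := by
      rw [one_add_div hr.ne', Real.rpow_neg (by positivity), Real.div_rpow hq.le hr.le, inv_div,
        div_mul_cancel₀ _ (Real.rpow_pos_of_pos hq a).ne']
    rw [add_mul, neg_add, Real.exp_add, ← hpow]
    ring
  · simp

theorem gammaPDFReal_mul_self {a r : ℝ} (ha : 0 < a) (hr : 0 < r) (x : ℝ) :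
    gammaPDFReal a r x * x = a / r * gammaPDFReal (a + 1) r x := by
  unfold gammaPDFReal
  split_ifs with hx
  · have hGamma : Real.Gamma a ≠ 0 := (Real.Gamma_pos_of_pos ha).ne'
    have hpow : x ^ (a - 1) * x = x ^ a := by
      rw [← Real.rpow_add_one' hx (by simpa using ha.ne'), sub_add_cancel]
    rw [Real.Gamma_add_one ha.ne', Real.rpow_add_one hr.ne', add_sub_cancel_right, ← hpow]
    field_simp
  · simp

@[fun_prop]
theorem measurable_gammaPDF (a r : ℝ) : Measurable (gammaPDF a r) :=
  (measurable_gammaPDFReal a r).ennreal_ofReal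

theorem lintegral_ofReal_gammaMeasure {a r a' r' C : ℝ} {F : ℝ → ℝ} (ha : 0 < a) (hr : 0 < r)
    (ha' : 0 < a') (hr' : 0 < r') (hC : 0 ≤ C) (hF : Measurable F)
    (h : ∀ x, gammaPDFReal a r x * F x = C * gammaPDFReal a' r' x) :
    ∫⁻ x, ENNReal.ofReal (F x) ∂(gammaMeasure a r) = ENNReal.ofReal C := by
  have hpoint (x : ℝ) :
      (gammaPDF a r * fun x => ENNReal.ofReal (F x)) x = ENNReal.ofReal C * gammaPDF a' r' x := by
    rw [Pi.mul_apply, gammaPDF, gammaPDF, ← ENNReal.ofReal_mul (gammaPDFReal_nonneg ha hr x),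
      ← ENNReal.ofReal_mul hC, h]
  rw [gammaMeasure, lintegral_withDensity_eq_lintegral_mul _ (by fun_prop) (by fun_prop)]
  simp only [hpoint]
  rw [lintegral_const_mul _ (by fun_prop), lintegral_gammaPDF_eq_one ha' hr', mul_one]

theorem lintegral_exp_gammaMeasure {a r q : ℝ} (ha : 0 < a) (hr : 0 < r) (hq : 0 < r + q) :
    ∫⁻ x, ENNReal.ofReal (Real.exp (-(q * x))) ∂(gammaMeasure a r) =
      ENNReal.ofReal ((1 + q / r) ^ (-a)) :=
  lintegral_ofReal_gammaMeasure ha hr ha hq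
    (Real.rpow_nonneg (by rw [one_add_div hr.ne']; positivity) _) (by fun_prop)
    (gammaPDFReal_mul_exp hr hq)

theorem lintegral_id_gammaMeasure {a r : ℝ} (ha : 0 < a) (hr : 0 < r) :
    ∫⁻ x, ENNReal.ofReal x ∂(gammaMeasure a r) = ENNReal.ofReal (a / r) :=
  lintegral_ofReal_gammaMeasure ha hr (add_pos ha one_pos) hr (by positivity) measurable_id
    (gammaPDFReal_mul_self ha hr)

theorem gammaMeasure_Iio_zero (a r : ℝ) : gammaMeasure a r (Iio 0) = 0 := by
  rw [gammaMeasure, withDensity_apply _ measurableSet_Iio]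
  exact lintegral_gammaPDF_of_nonpos le_rfl

/-- `law` is the mixture of the gamma distributions of shapes `β n` and common rate `θ` with
weights `c n`, and has a finite mean. Both fading laws are of this form, which reduces their
Laplace transforms to those of gamma distributions. -/
structure IsGammaMixture (law : Measure ℝ) (c β : ℕ → ℝ) (θ : ℝ) : Prop where
  rate_pos : 0 < θ
  weight_nonneg : ∀ n, 0 ≤ c n
  shape_pos : ∀ n, 0 < β n
  law_eq : law = Measure.sum fun n => ENNReal.ofReal (c n) • gammaMeasure (β n) θ
  summable_mean : Summable fun n => c n * β n

theorem withDensity_eq_sum_gammaMeasure {c β : ℕ → ℝ} {θ : ℝ} {pdf : ℝ → ℝ} (hθ : 0 < θ)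
    (hc : ∀ n, 0 ≤ c n) (hβ : ∀ n, 0 < β n) (hneg : ∀ x < 0, pdf x = 0)
    (hpos : ∀ x, 0 < x → HasSum (fun n => c n * gammaPDFReal (β n) θ x) (pdf x)) :
    volume.withDensity (fun x => ENNReal.ofReal (pdf x)) =
      Measure.sum fun n => ENNReal.ofReal (c n) • gammaMeasure (β n) θ := by
  have hpdf : (fun x => ENNReal.ofReal (pdf x)) =ᵐ[volume]
      ∑' n, (ENNReal.ofReal (c n) • gammaPDF (β n) θ) := by
    filter_upwards [Measure.ae_ne volume 0] with x hx
    rw [tsum_apply (Pi.summable.2 fun _ => ENNReal.summable)]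
    simp only [Pi.smul_apply, smul_eq_mul]
    rcases lt_or_gt_of_ne hx with hx | hx
    · simp [hneg x hx, gammaPDF_of_neg hx]
    · have hterm (n : ℕ) : 0 ≤ c n * gammaPDFReal (β n) θ x :=
        mul_nonneg (hc n) (gammaPDFReal_nonneg (hβ n) hθ x)
      rw [← (hpos x hx).tsum_eq, ENNReal.ofReal_tsum_of_nonneg hterm (hpos x hx).summable]
      exact tsum_congr fun n => ENNReal.ofReal_mul (hc n)
  rw [withDensity_congr_ae hpdf, withDensity_tsum fun n => (measurable_gammaPDF _ _).const_smul _]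
  simp only [withDensity_smul _ (measurable_gammaPDF _ _), gammaMeasure]

namespace IsGammaMixture

variable {law : Measure ℝ} {c β : ℕ → ℝ} {θ : ℝ}

theorem sFinite (h : IsGammaMixture law c β θ) : SFinite law := by
  have (n : ℕ) : SFinite (gammaMeasure (β n) θ) := by
    unfold gammaMeasure
    infer_instance
  rw [h.law_eq]
  infer_instance

theorem lintegral_eq_tsum (h : IsGammaMixture law c β θ) (F : ℝ → ℝ≥0∞) :
    ∫⁻ x, F x ∂law = ∑' n, ENNReal.ofReal (c n) * ∫⁻ x, F x ∂(gammaMeasure (β n) θ) := by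
  simp [h.law_eq, lintegral_sum_measure]

theorem ae_nonneg (h : IsGammaMixture law c β θ) : ∀ᵐ x ∂law, 0 ≤ x := by
  have hnull : law (Iio 0) = 0 := by
    simp [h.law_eq, Measure.sum_apply _ measurableSet_Iio, gammaMeasure_Iio_zero]
  filter_upwards [measure_eq_zero_iff_ae_notMem.1 hnull] with x hx
  exact not_lt.1 hx

theorem lintegral_expNeg_mul (h : IsGammaMixture law c β θ) {q : ℝ} (hq : 0 ≤ q) :
    ∫⁻ x, expNeg (ENNReal.ofReal (q * x)) ∂law =
      ∑' n, ENNReal.ofReal (c n * (1 + q / θ) ^ (-(β n))) := by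
  have hexp : ∀ᵐ x ∂law,
      expNeg (ENNReal.ofReal (q * x)) = ENNReal.ofReal (Real.exp (-(q * x))) := by
    filter_upwards [h.ae_nonneg] with x hx
    exact expNeg_ofReal (mul_nonneg hq hx)
  rw [lintegral_congr_ae hexp]
  simp only [h.lintegral_eq_tsum, ENNReal.ofReal_mul (h.weight_nonneg _),
    lintegral_exp_gammaMeasure (h.shape_pos _) h.rate_pos (add_pos_of_pos_of_nonneg h.rate_pos hq)]

theorem lintegral_id_ne_top (h : IsGammaMixture law c β θ) :
    ∫⁻ x, ENNReal.ofReal x ∂law ≠ ∞ := by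
  simp only [h.lintegral_eq_tsum, lintegral_id_gammaMeasure (h.shape_pos _) h.rate_pos,
    ← ENNReal.ofReal_mul (h.weight_nonneg _), ← mul_div_assoc]
  exact (h.summable_mean.div_const θ).tsum_ofReal_ne_top

end IsGammaMixture

/-! ### Fading laws as gamma mixtures -/

theorem pow_mul_Gamma_le {a : ℝ} (ha : 0 < a) (k : ℕ) :
    a ^ k * Real.Gamma a ≤ Real.Gamma (k + a) := by
  induction k with
  | zero => simp
  | succ k ih =>
    have := Real.Gamma_pos_of_pos ha
    calc a ^ (k + 1) * Real.Gamma a = a * (a ^ k * Real.Gamma a) := by ring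
      _ ≤ (k + a) * Real.Gamma (k + a) := by gcongr; simp
      _ = Real.Gamma ((k + 1 : ℕ) + a) := by
        rw [← Real.Gamma_add_one (by positivity)]; push_cast; ring_nf

theorem hasSum_besselISeries {nu : ℝ} (hnu : 0 < nu + 1) (z : ℝ) :
    HasSum (fun k : ℕ => (z / 2) ^ (2 * k) / ((Nat.factorial k : ℝ) * Real.Gamma (k + nu + 1)))
      (besselISeries nu z) := by
  have := Real.Gamma_pos_of_pos hnu
  have hle (k : ℕ) := pow_mul_Gamma_le hnu k
  simp only [← add_assoc] at hle
  have hpos (k : ℕ) : 0 < (nu + 1) ^ k * Real.Gamma (nu + 1) := by positivity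
  refine Summable.hasSum (Summable.of_nonneg_of_le (fun k => ?_) (fun k => ?_)
    ((Real.summable_pow_div_factorial ((z / 2) ^ 2 / (nu + 1))).mul_left (Real.Gamma (nu + 1))⁻¹))
  · have := (hpos k).trans_le (hle k)
    rw [pow_mul]
    positivity
  · calc (z / 2) ^ (2 * k) / ((Nat.factorial k : ℝ) * Real.Gamma (k + nu + 1))
        ≤ ((z / 2) ^ 2) ^ k / (Nat.factorial k * ((nu + 1) ^ k * Real.Gamma (nu + 1))) := by
          rw [pow_mul]
          gcongr
          exact hle k
      _ = (Real.Gamma (nu + 1))⁻¹ * (((z / 2) ^ 2 / (nu + 1)) ^ k / Nat.factorial k) := by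
          rw [div_pow _ (nu + 1)]
          field_simp

/-- Weight of the gamma distribution of shape `n + μ` in the `κ`-`μ` distribution: a Poisson
distribution of mean `μκ`. -/
noncomputable def kappaMuWeight (kappa mu : ℝ) (n : ℕ) : ℝ :=
  Real.exp (-(mu * kappa)) * ((mu * kappa) ^ n / (n.factorial : ℝ))

theorem kappaMuWeight_nonneg {kappa mu : ℝ} (hk : 0 ≤ kappa) (hmu : 0 ≤ mu) (n : ℕ) :
    0 ≤ kappaMuWeight kappa mu n := by
  unfold kappaMuWeight
  positivity

theorem summable_kappaMuWeight_mul_add {kappa mu : ℝ} (hk : 0 ≤ kappa) (hmu : 0 ≤ mu) :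
    Summable fun n => kappaMuWeight kappa mu n * (n + mu) := by
  have hle (n : ℕ) : (n : ℝ) + mu ≤ (1 + mu) * 2 ^ n := by
    have : (n : ℝ) ≤ 2 ^ n := by exact_mod_cast n.lt_two_pow_self.le
    have : mu * 1 ≤ mu * 2 ^ n := by gcongr; exact one_le_pow₀ one_le_two
    linarith
  refine Summable.of_nonneg_of_le
    (fun n => mul_nonneg (kappaMuWeight_nonneg hk hmu n) (by positivity))
    (fun n => (mul_le_mul_of_nonneg_left (hle n) (kappaMuWeight_nonneg hk hmu n)).trans_eq ?_)
    ((Real.summable_pow_div_factorial (2 * (mu * kappa))).mul_left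
      (Real.exp (-(mu * kappa)) * (1 + mu)))
  rw [kappaMuWeight, mul_pow]
  ring

theorem kappaMuPDF_of_pos {kappa mu w x : ℝ} (hk : 0 < kappa) (hmu : 0 < mu) (hw : 0 < w)
    (hx : 0 < x) :
    kappaMuPDF kappa mu w x =
      Real.exp (-(mu * kappa)) * ((mu * (1 + kappa) / w * x) ^ mu / x) *
        Real.exp (-(mu * (1 + kappa) / w * x)) *
        besselISeries (mu - 1) (2 * √(mu * kappa * (mu * (1 + kappa) / w * x))) := by
  obtain ⟨v, hv, hv_eq⟩ : ∃ v, 0 < v ∧ (1 + kappa) / w = v := ⟨_, by positivity, rfl⟩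
  have hrate : mu * (1 + kappa) / w = mu * v := by rw [← hv_eq, mul_div_assoc]
  have hsqrt : √(mu * kappa * (mu * v * x)) = mu * √(kappa * v * x) := by
    rw [show mu * kappa * (mu * v * x) = mu ^ 2 * (kappa * v * x) by ring,
      Real.sqrt_mul (by positivity), Real.sqrt_sq hmu.le]
  have hbessel : (mu * √(kappa * v * x)) ^ (mu - 1) =
      mu ^ mu / mu * (kappa ^ ((mu - 1) / 2) * v ^ ((mu - 1) / 2) * x ^ ((mu - 1) / 2)) := by
    rw [Real.mul_rpow hmu.le (Real.sqrt_nonneg _), Real.rpow_sub_one hmu.ne', Real.sqrt_eq_rpow,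
      ← Real.rpow_mul (by positivity), one_div_mul_eq_div, Real.mul_rpow (by positivity) hx.le,
      Real.mul_rpow hk.le hv.le]
  have hsquare (y : ℝ) (hy : 0 < y) : y ^ mu = y ^ ((mu - 1) / 2) * y ^ ((mu - 1) / 2) * y := by
    rw [← Real.rpow_add hy, ← Real.rpow_add_one hy.ne']
    ring_nf
  have hhalf : v ^ ((mu + 1) / 2) = v ^ ((mu - 1) / 2) * v := by
    rw [← Real.rpow_add_one hv.ne']
    ring_nf
  have hkappa : kappa ^ ((mu - 1) / 2) ≠ 0 := (Real.rpow_pos_of_pos hk _).ne'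
  rw [kappaMuPDF, if_pos hx, besselI, mul_div_assoc kappa, hrate, hv_eq, hsqrt,
    mul_assoc 2 mu, mul_div_cancel_left₀ _ two_ne_zero, hbessel, hhalf,
    Real.mul_rpow (by positivity) hx.le, Real.mul_rpow hmu.le hv.le, hsquare x hx, hsquare v hv,
    Real.exp_neg (mu * kappa)]
  field_simp

theorem hasSum_kappaMuPDF {kappa mu w x : ℝ} (hk : 0 < kappa) (hmu : 0 < mu) (hw : 0 < w)
    (hx : 0 < x) :
    HasSum (fun n : ℕ => kappaMuWeight kappa mu n *
      gammaPDFReal (n + mu) (mu * (1 + kappa) / w) x) (kappaMuPDF kappa mu w x) := by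
  rw [kappaMuPDF_of_pos hk hmu hw hx]
  refine ((hasSum_besselISeries (by linarith) _).mul_left _).congr_fun fun n => ?_
  have hrate : 0 < mu * (1 + kappa) / w := by positivity
  obtain ⟨y, hy, hy_eq⟩ : ∃ y, 0 < y ∧ mu * (1 + kappa) / w * x = y := ⟨_, by positivity, rfl⟩
  have hpow : √(mu * kappa * y) ^ (2 * n) = (mu * kappa) ^ n * y ^ n := by
    rw [pow_mul, Real.sq_sqrt (by positivity), mul_pow]
  rw [gammaPDFReal_of_pos hrate hx, hy_eq, mul_div_cancel_left₀ _ two_ne_zero, hpow,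
    kappaMuWeight, Real.rpow_add hy, Real.rpow_natCast,
    show (n : ℝ) + (mu - 1) + 1 = n + mu by ring]
  field_simp

theorem isGammaMixture_kappaMuLaw {kappa mu w : ℝ} (hk : 0 < kappa) (hmu : 0 < mu) (hw : 0 < w) :
    IsGammaMixture (kappaMuLaw kappa mu w) (kappaMuWeight kappa mu) (fun n => n + mu)
      (mu * (1 + kappa) / w) where
  rate_pos := by positivity
  weight_nonneg := kappaMuWeight_nonneg hk.le hmu.le
  shape_pos n := by positivity
  law_eq := withDensity_eq_sum_gammaMeasure (by positivity) (kappaMuWeight_nonneg hk.le hmu.le)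
    (fun n => by positivity) (fun x hx => if_neg hx.not_gt)
    fun x hx => hasSum_kappaMuPDF hk hmu hw hx
  summable_mean := summable_kappaMuWeight_mul_add hk.le hmu.le

theorem etaMuh_pos {eta : ℝ} (h : 0 < eta) : 0 < etaMuh eta := by
  unfold etaMuh
  positivity

theorem sq_etaMuH_div_etaMuh_lt_one {eta : ℝ} (h : 0 < eta) :
    (etaMuH eta / etaMuh eta) ^ 2 < 1 := by
  have := inv_pos.2 h
  have := etaMuh_pos h
  rw [div_pow, div_lt_one (by positivity)]
  refine sq_lt_sq' ?_ ?_ <;> (unfold etaMuh etaMuH; linarith)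

/-- Weight of the gamma distribution of shape `2n + 2μ` in the `η`-`μ` distribution: a negative
binomial distribution, as `h⁻² = 1 - (H/h)²`. -/
noncomputable def etaMuWeight (eta mu : ℝ) (n : ℕ) : ℝ :=
  Real.Gamma (n + mu) / (etaMuh eta ^ mu * Real.Gamma mu * (n.factorial : ℝ)) *
    (etaMuH eta / etaMuh eta) ^ (2 * n)

theorem etaMuWeight_nonneg {eta mu : ℝ} (he : 0 < eta) (hmu : 0 < mu) (n : ℕ) :
    0 ≤ etaMuWeight eta mu n := by
  have := etaMuh_pos he
  rw [etaMuWeight, pow_mul]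
  positivity

theorem etaMuWeight_succ {mu : ℝ} (eta : ℝ) (hmu : 0 < mu) (n : ℕ) :
    etaMuWeight eta mu (n + 1) =
      (etaMuH eta / etaMuh eta) ^ 2 * ((n + mu) / (n + 1)) * etaMuWeight eta mu n := by
  have hGamma : Real.Gamma ((n + 1 : ℕ) + mu) = (n + mu) * Real.Gamma (n + mu) := by
    rw [← Real.Gamma_add_one (by positivity)]
    push_cast
    ring_nf
  rw [etaMuWeight, etaMuWeight, hGamma, Nat.factorial_succ, mul_add_one, pow_add]
  push_cast
  field_simp

theorem summable_etaMuWeight_mul_add {eta mu : ℝ} (he : 0 < eta) (hmu : 0 < mu) :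
    Summable fun n => etaMuWeight eta mu n * (2 * n + 2 * mu) := by
  obtain ⟨q, hq, hq1⟩ := exists_between (sq_etaMuH_div_etaMuh_lt_one he)
  set ρ := (etaMuH eta / etaMuh eta) ^ 2 with hρ
  have hratio : Tendsto (fun n : ℕ => ρ + ρ * mu * (1 / ((n : ℝ) + 1))) atTop (𝓝 ρ) := by
    simpa using (tendsto_one_div_add_atTop_nhds_zero_nat (𝕜 := ℝ)).const_mul (ρ * mu)
      |>.const_add ρ
  have hnonneg (n : ℕ) : 0 ≤ etaMuWeight eta mu n * (2 * n + 2 * mu) :=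
    mul_nonneg (etaMuWeight_nonneg he hmu n) (by positivity)
  refine summable_of_ratio_norm_eventually_le hq1 ?_
  filter_upwards [hratio.eventually (eventually_lt_nhds hq)] with n hn
  rw [Real.norm_of_nonneg (hnonneg _), Real.norm_of_nonneg (hnonneg _)]
  refine le_trans (le_of_eq ?_) (mul_le_mul_of_nonneg_right hn.le (hnonneg n))
  rw [etaMuWeight_succ eta hmu, ← hρ]
  push_cast
  field_simp

theorem two_mul_sqrt_pi_div_Gamma_add_half {a : ℝ} (ha : 0 < a) :
    2 * √Real.pi / Real.Gamma (a + 1 / 2) =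
      2 ^ (2 * a) * Real.Gamma a / Real.Gamma (2 * a) := by
  rw [div_eq_div_iff (by positivity) (by positivity), mul_assoc (2 ^ (2 * a)),
    Real.Gamma_mul_Gamma_add_half, Real.rpow_sub two_pos, Real.rpow_one]
  field_simp

theorem etaMuPDF_of_pos {eta mu w x : ℝ} (he : 0 < eta) (hmu : 0 < mu) (hw : 0 < w)
    (hx : 0 < x) :
    etaMuPDF eta mu w x =
      2 * √Real.pi / (Real.Gamma mu * etaMuh eta ^ mu) *
        ((2 * mu * etaMuh eta / w * x / 2) ^ (2 * mu) / x) *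
        Real.exp (-(2 * mu * etaMuh eta / w * x)) *
        besselISeries (mu - 1 / 2)
          (etaMuH eta / etaMuh eta * (2 * mu * etaMuh eta / w * x)) := by
  have hh := etaMuh_pos he
  have hminus (y : ℝ) (hy : 0 < y) : y ^ (mu - 1 / 2) = y ^ mu / √y := by
    rw [Real.rpow_sub hy, Real.sqrt_eq_rpow]
  have hplus (y : ℝ) (hy : 0 < y) : y ^ (mu + 1 / 2) = y ^ mu * √y := by
    rw [Real.rpow_add hy, Real.sqrt_eq_rpow]
  have hdouble (y : ℝ) (hy : 0 < y) : y ^ (2 * mu) = y ^ mu * y ^ mu := by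
    rw [← Real.rpow_add hy, two_mul]
  rw [etaMuPDF, if_pos hx,
    show 2 * mu * etaMuh eta / w * x / 2 = etaMuh eta * (mu * x / w) by ring,
    show 2 * mu * etaMuH eta * x / w =
      etaMuH eta / etaMuh eta * (2 * mu * etaMuh eta / w * x) by field_simp,
    hdouble _ (by positivity), Real.mul_rpow hh.le (by positivity), hminus x hx,
    hminus (mu * x / w) (by positivity), hplus mu hmu, hplus w hw,
    Real.div_rpow (by positivity) hw.le, Real.mul_rpow hmu.le hx.le, Real.sqrt_div (by positivity),
    Real.sqrt_mul hmu.le]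
  field_simp
  rw [Real.sq_sqrt hx.le]

theorem hasSum_etaMuPDF {eta mu w x : ℝ} (he : 0 < eta) (hmu : 0 < mu) (hw : 0 < w)
    (hx : 0 < x) :
    HasSum (fun n : ℕ => etaMuWeight eta mu n *
      gammaPDFReal (2 * n + 2 * mu) (2 * mu * etaMuh eta / w) x) (etaMuPDF eta mu w x) := by
  have hh := etaMuh_pos he
  rw [etaMuPDF_of_pos he hmu hw hx]
  refine ((hasSum_besselISeries (by linarith) _).mul_left _).congr_fun fun n => ?_
  have hrate : 0 < 2 * mu * etaMuh eta / w := by positivity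
  obtain ⟨y, hy, hy_eq⟩ : ∃ y, 0 < y ∧ 2 * mu * etaMuh eta / w * x = y := ⟨_, by positivity, rfl⟩
  have hdup := two_mul_sqrt_pi_div_Gamma_add_half (a := n + mu) (by positivity)
  have hsplit (z : ℝ) (hz : 0 < z) :
      z ^ (2 * ((n : ℝ) + mu)) = z ^ (2 * n) * z ^ (2 * mu) := by
    rw [mul_add, Real.rpow_add hz]
    norm_cast
  rw [gammaPDFReal_of_pos hrate hx, hy_eq, etaMuWeight, ← mul_add,
    show (n : ℝ) + (mu - 1 / 2) + 1 = n + mu + 1 / 2 by ring]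
  calc
    _ = 2 ^ (2 * ((n : ℝ) + mu)) * Real.Gamma (n + mu) / Real.Gamma (2 * (n + mu)) *
        (1 / (Real.Gamma mu * etaMuh eta ^ mu) * ((y / 2) ^ (2 * mu) / x) * Real.exp (-y) *
          ((etaMuH eta / etaMuh eta * y / 2) ^ (2 * n) / n.factorial)) := by
      rw [hsplit 2 two_pos, hsplit y hy, Real.div_rpow hy.le two_pos.le, mul_div_assoc _ y 2,
        mul_pow, div_pow y]
      field_simp
    _ = _ := by
      rw [← hdup]
      ring

theorem isGammaMixture_etaMuLaw {eta mu w : ℝ} (he : 0 < eta) (hmu : 0 < mu) (hw : 0 < w) :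
    IsGammaMixture (etaMuLaw eta mu w) (etaMuWeight eta mu) (fun n => 2 * n + 2 * mu)
      (2 * mu * etaMuh eta / w) := by
  have hrate : 0 < 2 * mu * etaMuh eta / w := by have := etaMuh_pos he; positivity
  have hshape (n : ℕ) : 0 < 2 * (n : ℝ) + 2 * mu := by positivity
  exact {
    rate_pos := hrate
    weight_nonneg := etaMuWeight_nonneg he hmu
    shape_pos := hshape
    law_eq := withDensity_eq_sum_gammaMeasure hrate (etaMuWeight_nonneg he hmu) hshape
      (fun x hx => if_neg hx.not_gt) fun x hx => hasSum_etaMuPDF he hmu hw hx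
    summable_mean := summable_etaMuWeight_mul_add he hmu }

/-! ### The transform of a single mark -/

theorem cellRadius_pos {lamb : ℝ} (h : 0 < lamb) : 0 < cellRadius lamb := by
  unfold cellRadius
  positivity

theorem cellRadius_rpow {lamb : ℝ} (h : 0 < lamb) (tau : ℝ) :
    cellRadius lamb ^ tau = ((Real.pi * lamb) ^ (1 / (2 / tau)))⁻¹ := by
  rw [cellRadius, Real.sqrt_eq_rpow, ← Real.rpow_mul (by positivity), one_div (Real.pi * lamb),
    Real.inv_rpow (by positivity), one_div_div, one_div_mul_eq_div]

instance sFinite_cellularLinkLaw (lamb : ℝ) : SFinite (cellularLinkLaw lamb) := by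
  unfold cellularLinkLaw
  infer_instance

theorem lintegral_cellularLinkLaw (lamb : ℝ) {F : ℝ → ℝ≥0∞} (hF : Measurable F) :
    ∫⁻ l, F l ∂(cellularLinkLaw lamb) =
      ∫⁻ l in Ioc 0 (cellRadius lamb), ENNReal.ofReal (2 * Real.pi * lamb * l) * F l := by
  rw [cellularLinkLaw, withDensity_indicator measurableSet_Icc,
    lintegral_withDensity_eq_lintegral_mul _ (by fun_prop) hF, restrict_Ioc_eq_restrict_Icc]
  rfl

theorem ae_mem_Icc_cellularLinkLaw (lamb : ℝ) :
    ∀ᵐ l ∂(cellularLinkLaw lamb), l ∈ Icc 0 (cellRadius lamb) := by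
  rw [cellularLinkLaw, withDensity_indicator measurableSet_Icc]
  exact (withDensity_absolutelyContinuous _ _).ae_le (ae_restrict_mem measurableSet_Icc)

theorem incompleteBeta_nonneg (d b x : ℝ) : 0 ≤ incompleteBeta d b x := by
  refine setIntegral_nonneg measurableSet_Ioc fun t ht => ?_
  have := ht.1
  positivity

theorem integrableOn_incompleteBeta {d b : ℝ} (hd : 0 < d) (hb : 0 ≤ b) (x : ℝ) :
    IntegrableOn (fun t : ℝ => t ^ (d - 1) * (1 + t) ^ (-b)) (Ioc 0 x) := by
  have hpow : IntegrableOn (fun t : ℝ => t ^ (d - 1)) (Ioc 0 x) :=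
    (intervalIntegral.intervalIntegrable_rpow' (by linarith)).1
  refine hpow.mono' (by fun_prop) ?_
  filter_upwards [ae_restrict_mem measurableSet_Ioc] with t ht
  have := ht.1
  rw [Real.norm_of_nonneg (by positivity)]
  exact mul_le_of_le_one_right (by positivity)
    (Real.rpow_le_one_of_one_le_of_nonpos (by linarith) (by linarith))

theorem ofReal_incompleteBeta {d b : ℝ} (hd : 0 < d) (hb : 0 ≤ b) (x : ℝ) :
    ENNReal.ofReal (incompleteBeta d b x) =
      ∫⁻ t in Ioc 0 x, ENNReal.ofReal (t ^ (d - 1) * (1 + t) ^ (-b)) := by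
  refine ofReal_integral_eq_lintegral_ofReal (integrableOn_incompleteBeta hd hb x) ?_
  filter_upwards [ae_restrict_mem measurableSet_Ioc] with t ht
  have := ht.1
  simp only [Pi.zero_apply]
  positivity

theorem image_const_mul_rpow_Ioc {a p R : ℝ} (ha : 0 < a) (hp : 0 < p) (hR : 0 ≤ R) :
    (fun l : ℝ => a * l ^ p) '' Ioc 0 R = Ioc 0 (a * R ^ p) := by
  ext t
  constructor
  · rintro ⟨l, ⟨hl, hlR⟩, rfl⟩
    exact ⟨by positivity, mul_le_mul_of_nonneg_left (Real.rpow_le_rpow hl.le hlR hp.le) ha.le⟩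
  · rintro ⟨ht, htR⟩
    have hta : 0 < t / a := by positivity
    refine ⟨(t / a) ^ p⁻¹, ⟨by positivity, ?_⟩, ?_⟩
    · rwa [Real.rpow_inv_le_iff_of_pos hta.le hR hp, div_le_iff₀' ha]
    · simp only [Real.rpow_inv_rpow hta.le hp.ne', mul_div_cancel₀ t ha.ne']

theorem setLIntegral_comp_const_mul_rpow {a p R : ℝ} (ha : 0 < a) (hp : 0 < p) (hR : 0 ≤ R)
    (F : ℝ → ℝ≥0∞) :
    ∫⁻ l in Ioc 0 R, ENNReal.ofReal (a * (p * l ^ (p - 1))) * F (a * l ^ p) =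
      ∫⁻ t in Ioc 0 (a * R ^ p), F t := by
  have hderiv (l : ℝ) (hl : l ∈ Ioc 0 R) :
      HasDerivWithinAt (fun l => a * l ^ p) (a * (p * l ^ (p - 1))) (Ioc 0 R) l :=
    ((Real.hasDerivAt_rpow_const (Or.inl hl.1.ne')).const_mul a).hasDerivWithinAt
  have hinj : InjOn (fun l : ℝ => a * l ^ p) (Ioc 0 R) := fun x hx y hy hxy =>
    Real.rpow_left_injOn hp.ne' hx.1.le hy.1.le (mul_left_cancel₀ ha.ne' hxy)
  rw [← image_const_mul_rpow_Ioc ha hp hR,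
    lintegral_image_eq_lintegral_abs_deriv_mul measurableSet_Ioc hderiv hinj]
  refine setLIntegral_congr_fun measurableSet_Ioc fun l hl => ?_
  have := hl.1
  simp only [abs_of_pos (show 0 < a * (p * l ^ (p - 1)) by positivity)]

theorem setLIntegral_mul_one_add_rpow {a p b R : ℝ} (ha : 0 < a) (hp : 0 < p) (hb : 0 ≤ b)
    (hR : 0 ≤ R) :
    ∫⁻ l in Ioc 0 R, ENNReal.ofReal (2 * l * (1 + a * l ^ p) ^ (-b)) =
      ENNReal.ofReal (2 / p * a ^ (-(2 / p)) * incompleteBeta (2 / p) b (a * R ^ p)) := by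
  rw [ENNReal.ofReal_mul (by positivity), ofReal_incompleteBeta (by positivity) hb,
    ← setLIntegral_comp_const_mul_rpow ha hp hR, ← lintegral_const_mul' _ _ ENNReal.ofReal_ne_top]
  refine setLIntegral_congr_fun measurableSet_Ioc fun l hl => ?_
  have hl0 : 0 < l := hl.1
  have hpow : (a * l ^ p) ^ (2 / p - 1) = a ^ (2 / p) / a * (l ^ 2 / l ^ p) := by
    rw [Real.mul_rpow ha.le (by positivity), Real.rpow_sub_one ha.ne', ← Real.rpow_mul hl0.le,
      show p * (2 / p - 1) = 2 - p by field_simp, Real.rpow_sub hl0, Real.rpow_two]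
  rw [← ENNReal.ofReal_mul (by positivity), ← ENNReal.ofReal_mul (by positivity), hpow,
    Real.rpow_neg ha.le, Real.rpow_sub_one hl0.ne']
  field_simp

/-- Expectation over the mark `(L, G)` of the factor `exp(-s L^τ G r^{-τ})` contributed by a point
at distance `r`. -/
noncomputable def markTransform (lamb tau s : ℝ) (law : Measure ℝ) (r : ℝ) : ℝ≥0∞ :=
  ∫⁻ p, expNeg (ENNReal.ofReal (s * (p.1 ^ tau * p.2 * r ^ (-tau))))
    ∂((cellularLinkLaw lamb).prod law)

theorem measurable_markTransform (lamb tau s : ℝ) (law : Measure ℝ) [SFinite law] :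
    Measurable (markTransform lamb tau s law) :=
  Measurable.lintegral_prod_right' (f := fun q : ℝ × ℝ × ℝ =>
    expNeg (ENNReal.ofReal (s * (q.2.1 ^ tau * q.2.2 * q.1 ^ (-tau))))) (by fun_prop)

/-- The factor `πλ r² δ (θ/s)^δ` in front of the series in `φ`. -/
noncomputable def phiFactor (lamb tau s θ r : ℝ) : ℝ :=
  Real.pi * lamb * r ^ 2 * (2 / tau) * (θ / s) ^ (2 / tau)

/-- The upper limit `s / (θ (πλ)^{1/δ} r^τ)` of the incomplete beta integrals in `φ`, that is, the
reciprocal of the argument of the Meijer functions. -/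
noncomputable def phiLimit (lamb tau s θ r : ℝ) : ℝ :=
  (θ * (Real.pi * lamb) ^ (1 / (2 / tau)) * r ^ tau / s)⁻¹

section MarkTransform

variable {lamb tau s θ r : ℝ}

theorem phiFactor_pos (hlamb : 0 < lamb) (htau : 0 < tau) (hs : 0 < s) (hθ : 0 < θ) (hr : 0 < r) :
    0 < phiFactor lamb tau s θ r := by
  unfold phiFactor
  positivity

theorem phiFactor_eq (htau : 0 < tau) (hs : 0 < s) (hθ : 0 < θ) (hr : 0 < r) :
    phiFactor lamb tau s θ r =
      Real.pi * lamb * (2 / tau * (s * r ^ (-tau) / θ) ^ (-(2 / tau))) := by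
  have hinv : (s * r ^ (-tau) / θ)⁻¹ = r ^ tau * (θ / s) := by
    rw [Real.rpow_neg hr.le]
    field_simp
  rw [phiFactor, Real.rpow_neg (by positivity), ← Real.inv_rpow (by positivity), hinv,
    Real.mul_rpow (by positivity) (by positivity), ← Real.rpow_mul hr.le,
    mul_div_cancel₀ _ htau.ne', Real.rpow_two]
  ring

theorem phiLimit_eq (hlamb : 0 < lamb) (hr : 0 < r) :
    phiLimit lamb tau s θ r = s * r ^ (-tau) / θ * cellRadius lamb ^ tau := by
  rw [cellRadius_rpow hlamb, phiLimit, Real.rpow_neg hr.le]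
  field_simp

namespace IsGammaMixture

variable {law : Measure ℝ} {c β : ℕ → ℝ}

theorem markTransform_eq_tsum (h : IsGammaMixture law c β θ) (hlamb : 0 < lamb) (htau : 0 < tau)
    (hs : 0 < s) (hr : 0 < r) :
    markTransform lamb tau s law r = ∑' n, ENNReal.ofReal (phiFactor lamb tau s θ r *
      (c n * incompleteBeta (2 / tau) (β n) (phiLimit lamb tau s θ r))) := by
  have := h.sFinite
  have hθ := h.rate_pos
  have hc := h.weight_nonneg
  obtain ⟨a, ha, ha_eq⟩ : ∃ a, 0 < a ∧ s * r ^ (-tau) / θ = a := ⟨_, by positivity, rfl⟩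
  have hfading (l : ℝ) (hl : l ∈ Ioc 0 (cellRadius lamb)) :
      ENNReal.ofReal (2 * Real.pi * lamb * l) *
        ∫⁻ g, expNeg (ENNReal.ofReal (s * (l ^ tau * g * r ^ (-tau)))) ∂law =
      ∑' n, ENNReal.ofReal (Real.pi * lamb * c n) *
        ENNReal.ofReal (2 * l * (1 + a * l ^ tau) ^ (-(β n))) := by
    have hl0 : 0 < l := hl.1
    have hcomm (g : ℝ) : s * (l ^ tau * g * r ^ (-tau)) = s * r ^ (-tau) * l ^ tau * g := by ring
    simp only [hcomm]
    rw [h.lintegral_expNeg_mul (by positivity), ← ENNReal.tsum_mul_left, mul_div_right_comm, ha_eq]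
    refine tsum_congr fun n => ?_
    have := hc n
    rw [← ENNReal.ofReal_mul (by positivity), ← ENNReal.ofReal_mul (by positivity)]
    ring_nf
  have hmeas : Measurable fun l : ℝ =>
      ∫⁻ g, expNeg (ENNReal.ofReal (s * (l ^ tau * g * r ^ (-tau)))) ∂law :=
    Measurable.lintegral_prod_right' (f := fun q : ℝ × ℝ =>
      expNeg (ENNReal.ofReal (s * (q.1 ^ tau * q.2 * r ^ (-tau))))) (by fun_prop)
  rw [markTransform, lintegral_prod _ (by fun_prop), lintegral_cellularLinkLaw _ hmeas,
    setLIntegral_congr_fun measurableSet_Ioc hfading, lintegral_tsum fun n => by fun_prop,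
    phiFactor_eq htau hs hθ hr, phiLimit_eq hlamb hr, ha_eq]
  refine tsum_congr fun n => ?_
  have := hc n
  rw [lintegral_const_mul' _ _ ENNReal.ofReal_ne_top,
    setLIntegral_mul_one_add_rpow ha htau (h.shape_pos n).le (cellRadius_pos hlamb).le,
    ← ENNReal.ofReal_mul (by positivity)]
  ring_nf

theorem hasSum_weight_mul_incompleteBeta (h : IsGammaMixture law c β θ) (hlamb : 0 < lamb)
    (htau : 0 < tau) (hs : 0 < s) (hr : 0 < r) (hfin : markTransform lamb tau s law r ≠ ∞) :
    HasSum (fun n => c n * incompleteBeta (2 / tau) (β n) (phiLimit lamb tau s θ r))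
      ((markTransform lamb tau s law r).toReal / phiFactor lamb tau s θ r) := by
  have hfactor := phiFactor_pos hlamb htau hs h.rate_pos hr
  have hnonneg (n : ℕ) : 0 ≤ phiFactor lamb tau s θ r *
      (c n * incompleteBeta (2 / tau) (β n) (phiLimit lamb tau s θ r)) :=
    mul_nonneg hfactor.le (mul_nonneg (h.weight_nonneg n) (incompleteBeta_nonneg _ _ _))
  rw [h.markTransform_eq_tsum hlamb htau hs hr] at hfin ⊢
  have hsum := ENNReal.hasSum_toReal hfin
  rw [← ENNReal.tsum_toReal_eq fun _ => ENNReal.ofReal_ne_top] at hsum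
  simp only [ENNReal.toReal_ofReal (hnonneg _)] at hsum
  simpa only [mul_div_cancel_left₀ _ hfactor.ne'] using hsum.div_const (phiFactor lamb tau s θ r)

end IsGammaMixture

end MarkTransform

/-! ### Independently marked point processes -/

theorem one_sub_expNeg_le (x : ℝ≥0∞) : 1 - expNeg x ≤ x := by
  rcases eq_or_ne x ∞ with rfl | hx
  · exact le_top
  lift x to ℝ≥0 using hx
  rw [← ENNReal.ofReal_coe_nnreal, expNeg_ofReal x.coe_nonneg, ← ENNReal.ofReal_one,
    ← ENNReal.ofReal_sub _ (Real.exp_pos _).le]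
  exact ENNReal.ofReal_le_ofReal (by linarith [Real.one_sub_le_exp_neg x])

theorem expNeg_toENNReal_neg_log {y : ℝ≥0∞} (hy : y ≤ 1) :
    expNeg (-ENNReal.log y).toENNReal = y := by
  have hlog : 0 ≤ -ENNReal.log y := EReal.neg_nonneg.2 (ENNReal.log_le_zero_iff.2 hy)
  rw [expNeg, EReal.coe_toENNReal hlog, neg_neg, ENNReal.exp_log]

theorem lintegral_expNeg_le_one {γ : Type*} [MeasurableSpace γ] (Q : Measure γ)
    [IsProbabilityMeasure Q] (f : γ → ℝ≥0∞) : ∫⁻ z, expNeg (f z) ∂Q ≤ 1 :=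
  (lintegral_mono fun z => expNeg_le_one (f z)).trans_eq (by simp)

theorem one_sub_lintegral_expNeg_le {γ : Type*} [MeasurableSpace γ] (Q : Measure γ)
    [IsProbabilityMeasure Q] {f : γ → ℝ≥0∞} (hf : Measurable f) :
    1 - ∫⁻ z, expNeg (f z) ∂Q ≤ ∫⁻ z, f z ∂Q := by
  rw [tsub_le_iff_left, ← lintegral_add_left (by fun_prop)]
  calc (1 : ℝ≥0∞) = ∫⁻ _, 1 ∂Q := by simp
    _ ≤ ∫⁻ z, expNeg (f z) + f z ∂Q :=
      lintegral_mono fun z => tsub_le_iff_left.1 (one_sub_expNeg_le (f z))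

theorem tendsto_lintegral_prod_expNeg {Ω : Type*} [MeasurableSpace Ω] (P : Measure Ω)
    [IsFiniteMeasure P] {f : ℕ → Ω → ℝ≥0∞} (hf : ∀ j, Measurable (f j)) :
    Tendsto (fun N => ∫⁻ ω, ∏ j ∈ Finset.range N, expNeg (f j ω) ∂P) atTop
      (𝓝 (∫⁻ ω, expNeg (∑' j, f j ω) ∂P)) := by
  simp only [← expNeg_sum]
  refine tendsto_lintegral_of_dominated_convergence (fun _ => 1) (fun N => by fun_prop)
    (fun N => ae_of_all _ fun ω => expNeg_le_one _) (by simp) (ae_of_all _ fun ω => ?_)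
  exact (continuous_expNeg.tendsto _).comp ENNReal.summable.hasSum.tendsto_sum_nat

/-- The points `{X_j}` carry the marks `{Z_j}`, which are i.i.d. of law `Q` and independent of the
points. -/
structure IsIndepMarking {Ω α γ : Type*} [MeasurableSpace Ω] [MeasurableSpace α]
    [MeasurableSpace γ] (P : Measure Ω) (X : ℕ → Ω → α) (Z : ℕ → Ω → γ) (Q : Measure γ) :
    Prop where
  measurable_point : ∀ j, Measurable (X j)
  measurable_mark : ∀ j, Measurable (Z j)
  map_mark : ∀ j, P.map (Z j) = Q
  iIndepFun_mark : iIndepFun Z P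
  indepFun : IndepFun (fun ω j => X j ω) (fun ω j => Z j ω) P

namespace IsIndepMarking

variable {Ω α γ : Type*} [MeasurableSpace Ω] [MeasurableSpace α] [MeasurableSpace γ]
  {P : Measure Ω} {X : ℕ → Ω → α} {Z : ℕ → Ω → γ} {Q : Measure γ}

theorem lintegral_prod_mark (h : IsIndepMarking P X Z Q) {g : ℕ → γ → ℝ≥0∞}
    (hg : ∀ j, Measurable (g j)) (s : Finset ℕ) :
    ∫⁻ ω, ∏ j ∈ s, g j (Z j ω) ∂P = ∏ j ∈ s, ∫⁻ z, g j z ∂Q := by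
  have hind : iIndepFun (fun j ω => g j (Z j ω)) P := h.iIndepFun_mark.comp g hg
  rw [lintegral_prod_eq_prod_lintegral_of_indepFun s _ hind
    fun j => (hg j).comp (h.measurable_mark j)]
  exact Finset.prod_congr rfl fun j _ => by
    rw [← h.map_mark j, lintegral_map (hg j) (h.measurable_mark j)]

variable [IsProbabilityMeasure P]

theorem isProbabilityMeasure (h : IsIndepMarking P X Z Q) : IsProbabilityMeasure Q := by
  rw [← h.map_mark 0]
  exact Measure.isProbabilityMeasure_map (h.measurable_mark 0).aemeasurable

theorem lintegral_prod (h : IsIndepMarking P X Z Q) {g : α × γ → ℝ≥0∞} (hg : Measurable g)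
    (s : Finset ℕ) :
    ∫⁻ ω, ∏ j ∈ s, g (X j ω, Z j ω) ∂P = ∫⁻ ω, ∏ j ∈ s, ∫⁻ z, g (X j ω, z) ∂Q ∂P := by
  have := h.isProbabilityMeasure
  have hX : Measurable fun ω j => X j ω := measurable_pi_lambda _ h.measurable_point
  have hZ : Measurable fun ω j => Z j ω := measurable_pi_lambda _ h.measurable_mark
  have := Measure.isProbabilityMeasure_map (μ := P) hZ.aemeasurable
  have hF : Measurable fun p : (ℕ → α) × (ℕ → γ) => ∏ j ∈ s, g (p.1 j, p.2 j) := by fun_prop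
  have hmarks (x : ℕ → α) : ∫⁻ z, ∏ j ∈ s, g (x j, z j) ∂(P.map fun ω j => Z j ω) =
      ∏ j ∈ s, ∫⁻ z, g (x j, z) ∂Q := by
    rw [lintegral_map (by fun_prop) hZ,
      h.lintegral_prod_mark (g := fun j z => g (x j, z)) (fun j => by fun_prop) s]
  calc ∫⁻ ω, ∏ j ∈ s, g (X j ω, Z j ω) ∂P
      = ∫⁻ p, ∏ j ∈ s, g (p.1 j, p.2 j)
          ∂((P.map fun ω j => X j ω).prod (P.map fun ω j => Z j ω)) := by
        rw [← (indepFun_iff_map_prod_eq_prod_map_map hX.aemeasurable hZ.aemeasurable).1 h.indepFun,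
          lintegral_map hF (hX.prodMk hZ)]
    _ = ∫⁻ ω, ∏ j ∈ s, ∫⁻ z, g (X j ω, z) ∂Q ∂P := by
        rw [MeasureTheory.lintegral_prod _ hF.aemeasurable]
        simp only [hmarks]
        exact lintegral_map (Finset.measurable_prod _ fun j _ =>
          hg.lintegral_prod_right'.comp (measurable_pi_apply j)) hX

theorem lintegral_eq (h : IsIndepMarking P X Z Q) {g : α × γ → ℝ≥0∞} (hg : Measurable g)
    (j : ℕ) : ∫⁻ ω, g (X j ω, Z j ω) ∂P = ∫⁻ ω, ∫⁻ z, g (X j ω, z) ∂Q ∂P := by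
  simpa only [Finset.prod_singleton] using h.lintegral_prod hg {j}

end IsIndepMarking

namespace IsHomogeneousPPPOn

variable {Ω γ : Type*} [MeasurableSpace Ω] [MeasurableSpace γ] {P : Measure Ω}
  [IsProbabilityMeasure P] {X : ℕ → Ω → Plane} {Z : ℕ → Ω → γ} {Q : Measure γ} {D : Set Plane}
  {lam : ℝ} {f : Plane × γ → ℝ≥0∞}

theorem tsum_lintegral_marked (h : IsHomogeneousPPPOn P X D lam) (hZ : IsIndepMarking P X Z Q)
    (hlam : 0 ≤ lam) (hD : MeasurableSet D) (hf : Measurable f)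
    (hfD : ∀ x z, x ∉ D → f (x, z) = 0) :
    ∑' j, ∫⁻ ω, f (X j ω, Z j ω) ∂P = ENNReal.ofReal lam * ∫⁻ x, ∫⁻ z, f (x, z) ∂Q := by
  have := hZ.isProbabilityMeasure
  simp only [hZ.lintegral_eq hf]
  exact h.tsum_lintegral hlam hD hf.lintegral_prod_right' fun x hx => by simp [hfD x _ hx]

/-- Averaging over the marks turns the marked functional into the Laplace functional of the points
for the function `x ↦ -log ∫ exp(-f (x, z)) Q(dz)`. -/
theorem lintegral_expNeg_tsum_marked (h : IsHomogeneousPPPOn P X D lam)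
    (hZ : IsIndepMarking P X Z Q) (hlam : 0 ≤ lam) (hf : Measurable f)
    (hfD : ∀ x z, x ∉ D → f (x, z) = 0) :
    ∫⁻ ω, expNeg (∑' j, f (X j ω, Z j ω)) ∂P =
      expNeg (ENNReal.ofReal lam * ∫⁻ x, (1 - ∫⁻ z, expNeg (f (x, z)) ∂Q)) := by
  have := hZ.isProbabilityMeasure
  have hX := h.measurable
  have hZm := hZ.measurable_mark
  have hψ : Measurable fun x => ∫⁻ z, expNeg (f (x, z)) ∂Q :=
    (measurable_expNeg.comp hf).lintegral_prod_right'
  obtain ⟨φ, hφ, hφ_eq⟩ : ∃ φ : Plane → ℝ≥0∞, Measurable φ ∧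
      ∀ x, φ x = (-ENNReal.log (∫⁻ z, expNeg (f (x, z)) ∂Q)).toENNReal :=
    ⟨_, hψ.ennreal_log.neg.ereal_toENNReal, fun _ => rfl⟩
  have hexp (x : Plane) : expNeg (φ x) = ∫⁻ z, expNeg (f (x, z)) ∂Q := by
    rw [hφ_eq, expNeg_toENNReal_neg_log (lintegral_expNeg_le_one Q _)]
  have hφD (x : Plane) (hx : x ∉ D) : φ x = 0 := by
    simp [hφ_eq, hfD x _ hx, expNeg_zero]
  have hmarked := tendsto_lintegral_prod_expNeg P (f := fun j ω => f (X j ω, Z j ω)) (by fun_prop)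
  simp only [hZ.lintegral_prod (g := fun q => expNeg (f q)) (by fun_prop), ← hexp] at hmarked
  rw [tendsto_nhds_unique hmarked (tendsto_lintegral_prod_expNeg P fun j => hφ.comp (hX j)),
    h.lintegral_expNeg_tsum hlam hφ hφD]
  simp only [hexp]

end IsHomogeneousPPPOn

/-! ### The uplink model -/

section Plane

variable {R : ℝ} {E : Type*} [NormedAddCommGroup E] [NormedSpace ℝ E]

theorem pow_smul_indicator_Ici (F : ℝ → E) :
    (fun r : ℝ => r ^ (Module.finrank ℝ Plane - 1) • (Ici R).indicator F r) =
      (Ici R).indicator fun r => r • F r := by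
  ext r
  by_cases hr : r ∈ Ici R <;> simp [hr]

theorem Ici_inter_Ioi_zero (hR : 0 < R) : Ici R ∩ Ioi 0 = Ici R :=
  inter_eq_left.2 fun _ hr => hR.trans_le hr

theorem integrable_indicator_Ici_norm_iff (hR : 0 < R) (F : ℝ → E) :
    Integrable (fun x : Plane => (Ici R).indicator F ‖x‖) ↔
      IntegrableOn (fun r => r • F r) (Ioi R) := by
  rw [integrable_fun_norm_addHaar, pow_smul_indicator_Ici, IntegrableOn,
    integrable_indicator_iff measurableSet_Ici, IntegrableOn,
    Measure.restrict_restrict measurableSet_Ici, Ici_inter_Ioi_zero hR, ← IntegrableOn,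
    integrableOn_Ici_iff_integrableOn_Ioi]

theorem integral_indicator_Ici_norm (hR : 0 < R) (F : ℝ → E) :
    ∫ x : Plane, (Ici R).indicator F ‖x‖ = (2 * Real.pi) • ∫ r in Ioi R, r • F r := by
  have hball : (volume : Measure Plane).real (Metric.ball 0 1) = Real.pi := by
    simp [Measure.real, EuclideanSpace.volume_ball_fin_two, Real.pi_pos.le]
  rw [integral_fun_norm_addHaar, pow_smul_indicator_Ici, integral_indicator measurableSet_Ici,
    Measure.restrict_restrict measurableSet_Ici, Ici_inter_Ioi_zero hR,
    integral_Ici_eq_integral_Ioi, hball, finrank_euclideanSpace_fin, two_nsmul, two_mul, add_smul]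

end Plane

/-- The power received at the origin from a point `x` with mark `(l, g)`, namely `l^τ g ‖x‖^{-τ}`,
counted only outside the cell. -/
noncomputable def receivedPower (lamb tau : ℝ) (q : Plane × ℝ × ℝ) : ℝ :=
  (cell lamb)ᶜ.indicator (fun x => q.2.1 ^ tau * q.2.2 * ‖x‖ ^ (-tau)) q.1

theorem interferenceTerm_eq_receivedPower {Ω : Type*} (X : ℕ → Ω → Plane) (L G : ℕ → Ω → ℝ)
    (lamb tau : ℝ) (j : ℕ) (ω : Ω) :
    interferenceTerm X L G lamb tau j ω = receivedPower lamb tau (X j ω, L j ω, G j ω) :=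
  rfl

section ReceivedPower

variable {lamb tau : ℝ}

theorem measurableSet_compl_cell : MeasurableSet (cell lamb)ᶜ :=
  measurableSet_ball.compl

theorem receivedPower_eq_indicator_Ici (x : Plane) (p : ℝ × ℝ) :
    receivedPower lamb tau (x, p) =
      (Ici (cellRadius lamb)).indicator (fun r => p.1 ^ tau * p.2 * r ^ (-tau)) ‖x‖ := by
  simp [receivedPower, indicator, cell]

theorem receivedPower_of_notMem {x : Plane} (p : ℝ × ℝ) (hx : x ∉ (cell lamb)ᶜ) :
    receivedPower lamb tau (x, p) = 0 :=
  indicator_of_notMem hx _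

@[fun_prop]
theorem measurable_receivedPower : Measurable (receivedPower lamb tau) :=
  Measurable.indicator (f := fun q : Plane × ℝ × ℝ => q.2.1 ^ tau * q.2.2 * ‖q.1‖ ^ (-tau))
    (by fun_prop) (measurable_fst (measurableSet_compl_cell (lamb := lamb)))

theorem receivedPower_nonneg (x : Plane) {p : ℝ × ℝ} (hl : 0 ≤ p.1) (hg : 0 ≤ p.2) :
    0 ≤ receivedPower lamb tau (x, p) :=
  indicator_apply_nonneg fun _ => by positivity

theorem ofReal_receivedPower (x : Plane) (p : ℝ × ℝ) :
    ENNReal.ofReal (receivedPower lamb tau (x, p)) =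
      ENNReal.ofReal ((Ici (cellRadius lamb)).indicator (fun r => r ^ (-tau)) ‖x‖) *
        ENNReal.ofReal (p.1 ^ tau * p.2) := by
  rw [receivedPower_eq_indicator_Ici]
  by_cases hx : ‖x‖ ∈ Ici (cellRadius lamb)
  · rw [indicator_of_mem hx, indicator_of_mem hx, mul_comm, ENNReal.ofReal_mul (by positivity)]
  · simp [hx]

theorem lintegral_indicator_Ici_rpow_ne_top {R : ℝ} (hR : 0 < R) (htau : 2 < tau) :
    ∫⁻ x : Plane, ENNReal.ofReal ((Ici R).indicator (fun r => r ^ (-tau)) ‖x‖) ≠ ∞ := by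
  refine Integrable.lintegral_lt_top ?_ |>.ne
  rw [integrable_indicator_Ici_norm_iff hR]
  refine (integrableOn_Ioi_rpow_of_lt (show 1 + -tau < -1 by linarith) hR).congr_fun
    (fun r hr => ?_) measurableSet_Ioi
  simp only [smul_eq_mul, Real.rpow_one_add' (hR.trans hr).le (show 1 + -tau ≠ 0 by linarith)]

end ReceivedPower

namespace IsUplinkModel

variable {Ω : Type*} [MeasurableSpace Ω] {P : Measure Ω} [IsProbabilityMeasure P]
  {X : ℕ → Ω → Plane} {L G : ℕ → Ω → ℝ} {lamb tau s : ℝ} {law : Measure ℝ}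

theorem isProbabilityMeasure_fading (h : IsUplinkModel P X L G lamb law) :
    IsProbabilityMeasure law := by
  rw [← h.fading_law 0]
  exact Measure.isProbabilityMeasure_map (h.measurable_fading 0).aemeasurable

theorem isProbabilityMeasure_link (h : IsUplinkModel P X L G lamb law) :
    IsProbabilityMeasure (cellularLinkLaw lamb) := by
  rw [← h.link_law 0]
  exact Measure.isProbabilityMeasure_map (h.measurable_link 0).aemeasurable

theorem isIndepMarking (h : IsUplinkModel P X L G lamb law) :
    IsIndepMarking P X (fun j ω => (L j ω, G j ω)) ((cellularLinkLaw lamb).prod law) where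
  measurable_point := h.ppp.measurable
  measurable_mark j := (h.measurable_link j).prodMk (h.measurable_fading j)
  map_mark j := by
    rw [(indepFun_iff_map_prod_eq_prod_map_map (h.measurable_link j).aemeasurable
      (h.measurable_fading j).aemeasurable).1 (h.link_indep_fading j), h.link_law, h.fading_law]
  iIndepFun_mark := h.marks_indep
  indepFun := h.marks_indep_points

theorem ae_mark (h : IsUplinkModel P X L G lamb law) (hpos : ∀ᵐ g ∂law, 0 ≤ g) :
    ∀ᵐ p ∂((cellularLinkLaw lamb).prod law), p.1 ∈ Icc 0 (cellRadius lamb) ∧ 0 ≤ p.2 := by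
  have := h.isProbabilityMeasure_fading
  exact (Measure.quasiMeasurePreserving_fst.ae (ae_mem_Icc_cellularLinkLaw lamb)).and
    (Measure.quasiMeasurePreserving_snd.ae hpos)

theorem ae_interferenceTerm_nonneg (h : IsUplinkModel P X L G lamb law)
    (hpos : ∀ᵐ g ∂law, 0 ≤ g) : ∀ᵐ ω ∂P, ∀ j, 0 ≤ interferenceTerm X L G lamb tau j ω := by
  refine ae_all_iff.2 fun j => ?_
  have hmark := h.ae_mark hpos
  rw [← h.isIndepMarking.map_mark j] at hmark
  filter_upwards [ae_of_ae_map (h.isIndepMarking.measurable_mark j).aemeasurable hmark]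
    with ω hω
  exact receivedPower_nonneg (p := (L j ω, G j ω)) _ hω.1.1 hω.2

theorem measurable_interferenceTerm (h : IsUplinkModel P X L G lamb law) (j : ℕ) :
    Measurable (interferenceTerm X L G lamb tau j) := by
  have hX := h.ppp.measurable j
  have hmark := h.isIndepMarking.measurable_mark j
  change Measurable fun ω => receivedPower lamb tau (X j ω, L j ω, G j ω)
  fun_prop

theorem lintegral_mark_ne_top (h : IsUplinkModel P X L G lamb law) (hpos : ∀ᵐ g ∂law, 0 ≤ g)
    (hmean : ∫⁻ g, ENNReal.ofReal g ∂law ≠ ∞) (htau : 0 ≤ tau) :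
    ∫⁻ p, ENNReal.ofReal (p.1 ^ tau * p.2) ∂((cellularLinkLaw lamb).prod law) ≠ ∞ := by
  have := h.isProbabilityMeasure_fading
  have := h.isProbabilityMeasure_link
  rw [← lt_top_iff_ne_top]
  calc ∫⁻ p, ENNReal.ofReal (p.1 ^ tau * p.2) ∂((cellularLinkLaw lamb).prod law)
      ≤ ∫⁻ p, ENNReal.ofReal (cellRadius lamb ^ tau) * ENNReal.ofReal p.2
          ∂((cellularLinkLaw lamb).prod law) := by
        refine lintegral_mono_ae ?_
        filter_upwards [h.ae_mark hpos] with p ⟨⟨hl, hlR⟩, hg⟩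
        rw [← ENNReal.ofReal_mul (Real.rpow_nonneg (hl.trans hlR) _)]
        gcongr
    _ = ENNReal.ofReal (cellRadius lamb ^ tau) * ∫⁻ g, ENNReal.ofReal g ∂law := by
        rw [lintegral_prod _ (by fun_prop)]
        simp only [lintegral_const, measure_univ, mul_one,
          lintegral_const_mul' _ _ ENNReal.ofReal_ne_top]
    _ < ∞ := ENNReal.mul_lt_top ENNReal.ofReal_lt_top hmean.lt_top

theorem lintegral_receivedPower_ne_top (h : IsUplinkModel P X L G lamb law)
    (hpos : ∀ᵐ g ∂law, 0 ≤ g) (hmean : ∫⁻ g, ENNReal.ofReal g ∂law ≠ ∞) (hlamb : 0 < lamb)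
    (htau : 2 < tau) :
    ∫⁻ x, ∫⁻ p, ENNReal.ofReal (receivedPower lamb tau (x, p))
      ∂((cellularLinkLaw lamb).prod law) ≠ ∞ := by
  simp only [ofReal_receivedPower, lintegral_const_mul' _ _ ENNReal.ofReal_ne_top]
  have hmark := h.lintegral_mark_ne_top hpos hmean (by linarith : 0 ≤ tau)
  rw [lintegral_mul_const' _ _ hmark]
  exact ENNReal.mul_ne_top
    (lintegral_indicator_Ici_rpow_ne_top (cellRadius_pos hlamb) htau) hmark

theorem ae_summable (h : IsUplinkModel P X L G lamb law)
    (hpos : ∀ᵐ g ∂law, 0 ≤ g) (hmean : ∫⁻ g, ENNReal.ofReal g ∂law ≠ ∞) (hlamb : 0 < lamb)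
    (htau : 2 < tau) : ∀ᵐ ω ∂P, Summable fun j => interferenceTerm X L G lamb tau j ω := by
  have hmeas (j : ℕ) : Measurable fun ω =>
      ENNReal.ofReal (interferenceTerm X L G lamb tau j ω) :=
    (h.measurable_interferenceTerm j).ennreal_ofReal
  have htotal : ∫⁻ ω, ∑' j, ENNReal.ofReal (interferenceTerm X L G lamb tau j ω) ∂P ≠ ∞ := by
    rw [lintegral_tsum fun j => (hmeas j).aemeasurable]
    simp only [interferenceTerm_eq_receivedPower]
    rw [h.ppp.tsum_lintegral_marked (f := fun q => ENNReal.ofReal (receivedPower lamb tau q))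
      h.isIndepMarking hlamb.le measurableSet_compl_cell (by fun_prop)
      fun x p hx => by rw [receivedPower_of_notMem p hx, ENNReal.ofReal_zero]]
    exact ENNReal.mul_ne_top ENNReal.ofReal_ne_top
      (h.lintegral_receivedPower_ne_top hpos hmean hlamb htau)
  filter_upwards [ae_lt_top (Measurable.tsum hmeas) htotal,
    h.ae_interferenceTerm_nonneg hpos] with ω hfin hnonneg
  exact (ENNReal.summable_toReal hfin.ne).congr fun j => ENNReal.toReal_ofReal (hnonneg j)

theorem markTransform_le_one (h : IsUplinkModel P X L G lamb law) (r : ℝ) :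
    markTransform lamb tau s law r ≤ 1 :=
  have := h.isIndepMarking.isProbabilityMeasure
  lintegral_expNeg_le_one _ _

theorem markTransform_ne_top (h : IsUplinkModel P X L G lamb law) (r : ℝ) :
    markTransform lamb tau s law r ≠ ∞ :=
  ne_top_of_le_ne_top ENNReal.one_ne_top (h.markTransform_le_one r)

theorem indicator_one_sub_markTransform_nonneg (h : IsUplinkModel P X L G lamb law) (x : Plane) :
    0 ≤ (Ici (cellRadius lamb)).indicator
      (fun r => 1 - (markTransform lamb tau s law r).toReal) ‖x‖ :=
  indicator_apply_nonneg fun _ =>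
    sub_nonneg.2 (ENNReal.toReal_mono ENNReal.one_ne_top (h.markTransform_le_one _))

theorem one_sub_lintegral_expNeg_receivedPower (h : IsUplinkModel P X L G lamb law) (x : Plane) :
    1 - ∫⁻ p, expNeg (ENNReal.ofReal (s * receivedPower lamb tau (x, p)))
        ∂((cellularLinkLaw lamb).prod law) =
      ENNReal.ofReal ((Ici (cellRadius lamb)).indicator
        (fun r => 1 - (markTransform lamb tau s law r).toReal) ‖x‖) := by
  have := h.isIndepMarking.isProbabilityMeasure
  simp only [receivedPower_eq_indicator_Ici]
  by_cases hx : ‖x‖ ∈ Ici (cellRadius lamb)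
  · simp only [indicator_of_mem hx]
    rw [ENNReal.ofReal_sub _ ENNReal.toReal_nonneg, ENNReal.ofReal_one,
      ENNReal.ofReal_toReal (h.markTransform_ne_top _), markTransform]
  · simp [hx, expNeg_zero]

theorem integrable_one_sub_markTransform (h : IsUplinkModel P X L G lamb law)
    (hpos : ∀ᵐ g ∂law, 0 ≤ g) (hmean : ∫⁻ g, ENNReal.ofReal g ∂law ≠ ∞) (hlamb : 0 < lamb)
    (htau : 2 < tau) (hs : 0 ≤ s) :
    Integrable fun x : Plane => (Ici (cellRadius lamb)).indicator
      (fun r => 1 - (markTransform lamb tau s law r).toReal) ‖x‖ := by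
  have := h.isProbabilityMeasure_fading
  have := h.isIndepMarking.isProbabilityMeasure
  have hmeas : Measurable fun r => 1 - (markTransform lamb tau s law r).toReal :=
    measurable_const.sub (measurable_markTransform _ _ _ _).ennreal_toReal
  refine ⟨((hmeas.indicator measurableSet_Ici).comp measurable_norm).aestronglyMeasurable, ?_⟩
  rw [hasFiniteIntegral_iff_ofReal (ae_of_all _ h.indicator_one_sub_markTransform_nonneg)]
  simp only [← h.one_sub_lintegral_expNeg_receivedPower]
  calc ∫⁻ x, (1 - ∫⁻ p, expNeg (ENNReal.ofReal (s * receivedPower lamb tau (x, p)))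
          ∂((cellularLinkLaw lamb).prod law))
      ≤ ∫⁻ x, ∫⁻ p, ENNReal.ofReal (s * receivedPower lamb tau (x, p))
          ∂((cellularLinkLaw lamb).prod law) :=
        lintegral_mono fun x => one_sub_lintegral_expNeg_le _ (by fun_prop)
    _ = ENNReal.ofReal s * ∫⁻ x, ∫⁻ p, ENNReal.ofReal (receivedPower lamb tau (x, p))
          ∂((cellularLinkLaw lamb).prod law) := by
        simp only [ENNReal.ofReal_mul hs, lintegral_const_mul' _ _ ENNReal.ofReal_ne_top]
    _ < ∞ := ENNReal.mul_lt_top ENNReal.ofReal_lt_top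
        (h.lintegral_receivedPower_ne_top hpos hmean hlamb htau).lt_top

theorem lintegral_exp_interference (h : IsUplinkModel P X L G lamb law)
    (hpos : ∀ᵐ g ∂law, 0 ≤ g) (hmean : ∫⁻ g, ENNReal.ofReal g ∂law ≠ ∞) (hlamb : 0 < lamb)
    (htau : 2 < tau) (hs : 0 ≤ s) :
    ∫⁻ ω, ENNReal.ofReal (Real.exp (-(s * interference X L G lamb tau ω))) ∂P =
      expNeg (ENNReal.ofReal lamb * ∫⁻ x : Plane, ENNReal.ofReal
        ((Ici (cellRadius lamb)).indicator
          (fun r => 1 - (markTransform lamb tau s law r).toReal) ‖x‖)) := by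
  have hterms : ∀ᵐ ω ∂P, ENNReal.ofReal (Real.exp (-(s * interference X L G lamb tau ω))) =
      expNeg (∑' j, ENNReal.ofReal (s * receivedPower lamb tau (X j ω, L j ω, G j ω))) := by
    filter_upwards [h.ae_summable hpos hmean hlamb htau,
      h.ae_interferenceTerm_nonneg hpos] with ω hsum hnonneg
    simp only [← interferenceTerm_eq_receivedPower]
    rw [interference, ← tsum_mul_left, ← ENNReal.ofReal_tsum_of_nonneg
      (fun j => mul_nonneg hs (hnonneg j)) (hsum.mul_left s), expNeg_ofReal
      (tsum_nonneg fun j => mul_nonneg hs (hnonneg j))]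
  rw [lintegral_congr_ae hterms, h.ppp.lintegral_expNeg_tsum_marked
    (f := fun q => ENNReal.ofReal (s * receivedPower lamb tau q)) h.isIndepMarking hlamb.le
    (by fun_prop) fun x p hx => by simp [receivedPower_of_notMem p hx]]
  simp only [h.one_sub_lintegral_expNeg_receivedPower]

theorem integrableOn_one_sub_markTransform (h : IsUplinkModel P X L G lamb law)
    (hpos : ∀ᵐ g ∂law, 0 ≤ g) (hmean : ∫⁻ g, ENNReal.ofReal g ∂law ≠ ∞) (hlamb : 0 < lamb)
    (htau : 2 < tau) (hs : 0 ≤ s) :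
    IntegrableOn (fun r => r • (1 - (markTransform lamb tau s law r).toReal))
      (Ioi (cellRadius lamb)) :=
  (integrable_indicator_Ici_norm_iff (cellRadius_pos hlamb) _).1
    (h.integrable_one_sub_markTransform hpos hmean hlamb htau hs)

theorem laplaceTransform_interference (h : IsUplinkModel P X L G lamb law)
    (hpos : ∀ᵐ g ∂law, 0 ≤ g) (hmean : ∫⁻ g, ENNReal.ofReal g ∂law ≠ ∞) (hlamb : 0 < lamb)
    (htau : 2 < tau) (hs : 0 ≤ s) :
    laplaceTransform P (interference X L G lamb tau) s =
      Real.exp (-(2 * Real.pi * lamb * ∫ r in Ioi (cellRadius lamb),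
        r • (1 - (markTransform lamb tau s law r).toReal))) := by
  have hnonneg := h.indicator_one_sub_markTransform_nonneg (tau := tau) (s := s)
  have hmeas : Measurable fun ω => Real.exp (-(s * interference X L G lamb tau ω)) :=
    ((Measurable.tsum h.measurable_interferenceTerm).const_mul s).neg.exp
  rw [laplaceTransform, integral_eq_lintegral_of_nonneg_ae
    (ae_of_all _ fun ω => (Real.exp_pos _).le) hmeas.aestronglyMeasurable,
    h.lintegral_exp_interference hpos hmean hlamb htau hs,
    ← ofReal_integral_eq_lintegral_ofReal
      (h.integrable_one_sub_markTransform hpos hmean hlamb htau hs) (ae_of_all _ hnonneg),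
    ← ENNReal.ofReal_mul hlamb.le, expNeg_ofReal (mul_nonneg hlamb.le (integral_nonneg hnonneg)),
    integral_indicator_Ici_norm (cellRadius_pos hlamb), ENNReal.toReal_ofReal (Real.exp_pos _).le,
    smul_eq_mul]
  ring_nf

theorem integrableOn_and_laplaceTransform_eq_cexp (h : IsUplinkModel P X L G lamb law)
    (hpos : ∀ᵐ g ∂law, 0 ≤ g) (hmean : ∫⁻ g, ENNReal.ofReal g ∂law ≠ ∞) (hlamb : 0 < lamb)
    (htau : 2 < tau) (hs : 0 ≤ s) {φ : ℝ → ℂ}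
    (hφ : ∀ r ∈ Ioi (cellRadius lamb), φ r = (markTransform lamb tau s law r).toReal) :
    IntegrableOn (fun r : ℝ => (1 - φ r) * r) (Ioi (cellRadius lamb)) ∧
      (laplaceTransform P (interference X L G lamb tau) s : ℂ) =
        Complex.exp (-(2 * Real.pi * lamb *
          ∫ r : ℝ in Ioi (cellRadius lamb), (1 - φ r) * (r : ℂ))) := by
  have heq : EqOn (fun r => ((r • (1 - (markTransform lamb tau s law r).toReal) : ℝ) : ℂ))
      (fun r : ℝ => (1 - φ r) * r) (Ioi (cellRadius lamb)) := fun r hr => by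
    simp only [hφ r hr, smul_eq_mul, mul_comm r, Complex.ofReal_mul, Complex.ofReal_sub,
      Complex.ofReal_one]
  constructor
  · exact IntegrableOn.congr_fun (Integrable.ofReal
      (h.integrableOn_one_sub_markTransform hpos hmean hlamb htau hs)) heq measurableSet_Ioi
  · rw [← setIntegral_congr_fun measurableSet_Ioi heq, integral_complex_ofReal,
      h.laplaceTransform_interference hpos hmean hlamb htau hs]
    push_cast
    rfl

end IsUplinkModel

/-! ### The series for `φ` -/

section Phi

variable {kappa eta mu w lamb tau s r : ℝ}

theorem kappaMuArg_pos (hk : 0 < kappa) (hmu : 0 < mu) (hw : 0 < w) (hlamb : 0 < lamb)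
    (hs : 0 < s) (hr : 0 < r) : 0 < kappaMuArg kappa mu w lamb tau s r := by
  unfold kappaMuArg
  positivity

theorem inv_kappaMuArg :
    (kappaMuArg kappa mu w lamb tau s r)⁻¹ = phiLimit lamb tau s (mu * (1 + kappa) / w) r := by
  rw [kappaMuArg, phiLimit]
  ring_nf

theorem kappaMuTerm_eq (hk : 0 < kappa) (hmu : 0 < mu) (hw : 0 < w) (hlamb : 0 < lamb)
    (htau : 0 < tau) (hs : 0 < s) (hr : 0 < r) (n : ℕ) :
    kappaMuTerm kappa mu w lamb tau s r n =
      ((Real.exp (mu * kappa) * (kappaMuWeight kappa mu n * incompleteBeta (2 / tau) (n + mu)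
        (phiLimit lamb tau s (mu * (1 + kappa) / w) r)) : ℝ) : ℂ) := by
  have hGamma : Real.Gamma (n + mu) ≠ 0 := (Real.Gamma_pos_of_pos (by positivity)).ne'
  rw [kappaMuTerm, meijerG_eq (by positivity) (by positivity)
    (kappaMuArg_pos hk hmu hw hlamb hs hr), inv_kappaMuArg, ← Complex.ofReal_mul, kappaMuWeight,
    Real.exp_neg, add_comm mu]
  congr 1
  field_simp

theorem etaMuArg_pos (he : 0 < eta) (hmu : 0 < mu) (hw : 0 < w) (hlamb : 0 < lamb)
    (hs : 0 < s) (hr : 0 < r) : 0 < etaMuArg eta mu w lamb tau s r := by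
  have := etaMuh_pos he
  unfold etaMuArg
  positivity

theorem inv_etaMuArg :
    (etaMuArg eta mu w lamb tau s r)⁻¹ = phiLimit lamb tau s (2 * mu * etaMuh eta / w) r := by
  rw [etaMuArg, phiLimit]
  ring_nf

theorem etaMuTerm_eq (he : 0 < eta) (hmu : 0 < mu) (hw : 0 < w) (hlamb : 0 < lamb)
    (htau : 0 < tau) (hs : 0 < s) (hr : 0 < r) (n : ℕ) :
    etaMuTerm eta mu w lamb tau s r n =
      ((Real.Gamma mu * etaMuh eta ^ mu / (2 * √Real.pi) * (etaMuWeight eta mu n *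
        incompleteBeta (2 / tau) (2 * n + 2 * mu)
          (phiLimit lamb tau s (2 * mu * etaMuh eta / w) r)) : ℝ) : ℂ) := by
  have hh := Real.rpow_pos_of_pos (etaMuh_pos he) mu
  have := Real.Gamma_pos_of_pos hmu
  have : 0 < Real.Gamma (2 * (n + mu)) := Real.Gamma_pos_of_pos (by positivity)
  have := Real.sqrt_pos.2 Real.pi_pos
  have hhalf : (Real.Gamma (n + mu + 1 / 2))⁻¹ = 2 ^ (2 * (n + mu)) * Real.Gamma (n + mu) /
      Real.Gamma (2 * (n + mu)) / (2 * √Real.pi) := by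
    rw [← two_mul_sqrt_pi_div_Gamma_add_half (by positivity)]
    field_simp
  rw [etaMuTerm, meijerG_eq (by positivity) (by positivity)
    (etaMuArg_pos he hmu hw hlamb hs hr), inv_etaMuArg, ← Complex.ofReal_mul, etaMuWeight,
    show mu + n + 1 / 2 = n + mu + 1 / 2 by ring, ← div_div, div_eq_mul_inv _ (Real.Gamma _),
    hhalf, show -2 * (n : ℝ) - 2 * mu = -(2 * (n + mu)) by ring, Real.rpow_neg two_pos.le,
    show 2 * (n : ℝ) + 2 * mu = 2 * (n + mu) by ring]
  congr 1
  field_simp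

theorem hasSum_kappaMuTerm (hk : 0 < kappa) (hmu : 0 < mu) (hw : 0 < w) (hlamb : 0 < lamb)
    (htau : 0 < tau) (hs : 0 < s) (hr : 0 < r)
    (hfin : markTransform lamb tau s (kappaMuLaw kappa mu w) r ≠ ∞) :
    HasSum (kappaMuTerm kappa mu w lamb tau s r)
      ((Real.exp (mu * kappa) * ((markTransform lamb tau s (kappaMuLaw kappa mu w) r).toReal /
        phiFactor lamb tau s (mu * (1 + kappa) / w) r) : ℝ) : ℂ) := by
  rw [funext (kappaMuTerm_eq hk hmu hw hlamb htau hs hr)]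
  exact Complex.hasSum_ofReal.2 (((isGammaMixture_kappaMuLaw hk hmu hw
    ).hasSum_weight_mul_incompleteBeta hlamb htau hs hr hfin).mul_left _)

theorem phiKappaMu_eq_markTransform (hk : 0 < kappa) (hmu : 0 < mu) (hw : 0 < w)
    (hlamb : 0 < lamb) (htau : 0 < tau) (hs : 0 < s) (hr : 0 < r)
    (hfin : markTransform lamb tau s (kappaMuLaw kappa mu w) r ≠ ∞) :
    phiKappaMu kappa mu w lamb tau s r =
      (markTransform lamb tau s (kappaMuLaw kappa mu w) r).toReal := by
  rw [phiKappaMu, (hasSum_kappaMuTerm hk hmu hw hlamb htau hs hr hfin).tsum_eq,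
    ← Complex.ofReal_mul, phiFactor, div_div (mu * (1 + kappa)), mul_comm w s]
  congr 1
  field_simp

theorem hasSum_etaMuTerm (he : 0 < eta) (hmu : 0 < mu) (hw : 0 < w) (hlamb : 0 < lamb)
    (htau : 0 < tau) (hs : 0 < s) (hr : 0 < r)
    (hfin : markTransform lamb tau s (etaMuLaw eta mu w) r ≠ ∞) :
    HasSum (etaMuTerm eta mu w lamb tau s r)
      ((Real.Gamma mu * etaMuh eta ^ mu / (2 * √Real.pi) *
        ((markTransform lamb tau s (etaMuLaw eta mu w) r).toReal /
          phiFactor lamb tau s (2 * mu * etaMuh eta / w) r) : ℝ) : ℂ) := by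
  rw [funext (etaMuTerm_eq he hmu hw hlamb htau hs hr)]
  exact Complex.hasSum_ofReal.2 (((isGammaMixture_etaMuLaw he hmu hw
    ).hasSum_weight_mul_incompleteBeta hlamb htau hs hr hfin).mul_left _)

theorem phiEtaMu_eq_markTransform (he : 0 < eta) (hmu : 0 < mu) (hw : 0 < w)
    (hlamb : 0 < lamb) (htau : 0 < tau) (hs : 0 < s) (hr : 0 < r)
    (hfin : markTransform lamb tau s (etaMuLaw eta mu w) r ≠ ∞) :
    phiEtaMu eta mu w lamb tau s r =
      (markTransform lamb tau s (etaMuLaw eta mu w) r).toReal := by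
  have hh := etaMuh_pos he
  have := Real.Gamma_pos_of_pos hmu
  have := Real.sqrt_pos.2 Real.pi_pos
  rw [phiEtaMu, (hasSum_etaMuTerm he hmu hw hlamb htau hs hr hfin).tsum_eq,
    ← Complex.ofReal_mul, phiFactor, div_div (2 * mu * etaMuh eta), mul_comm w s,
    show (3 / 2 : ℝ) = 1 + 1 / 2 by norm_num, Real.rpow_add Real.pi_pos, Real.rpow_one,
    ← Real.sqrt_eq_rpow]
  congr 1
  field_simp

end Phi

theorem mainTheorem5 {Ω : Type*} [MeasurableSpace Ω] (P : MeasureTheory.Measure Ω)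
    [MeasureTheory.IsProbabilityMeasure P]
    (X : ℕ → Ω → Plane) (L G : ℕ → Ω → ℝ) (lamb tau mu w s : ℝ)
    (hlamb : 0 < lamb) (htau : 2 < tau) (hmu : 0 < mu) (hw : 0 < w) (hs : 0 < s) :
    (∀ kappa : ℝ, 0 < kappa → IsUplinkModel P X L G lamb (kappaMuLaw kappa mu w) →
      (∀ᵐ ω ∂P, Summable fun j => interferenceTerm X L G lamb tau j ω) ∧
      (∀ r : ℝ, cellRadius lamb ≤ r →
        (∀ n : ℕ, MeijerGWellDefined 2 1 (upperParams (2 / tau)) (lowerParams (2 / tau) (n + mu))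
          (kappaMuArg kappa mu w lamb tau s r : ℂ)) ∧
        Summable (kappaMuTerm kappa mu w lamb tau s r)) ∧
      MeasureTheory.IntegrableOn
        (fun r : ℝ => (1 - phiKappaMu kappa mu w lamb tau s r) * (r : ℂ))
        (Set.Ioi (cellRadius lamb)) ∧
      (laplaceTransform P (interference X L G lamb tau) s : ℂ) =
        Complex.exp (-(2 * Real.pi * lamb *
          ∫ r : ℝ in Set.Ioi (cellRadius lamb),
            (1 - phiKappaMu kappa mu w lamb tau s r) * (r : ℂ)))) ∧
    (∀ eta : ℝ, 0 < eta → IsUplinkModel P X L G lamb (etaMuLaw eta mu w) →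
      (∀ᵐ ω ∂P, Summable fun j => interferenceTerm X L G lamb tau j ω) ∧
      (∀ r : ℝ, cellRadius lamb ≤ r →
        (∀ n : ℕ, MeijerGWellDefined 2 1 (upperParams (2 / tau))
          (lowerParams (2 / tau) (2 * n + 2 * mu)) (etaMuArg eta mu w lamb tau s r : ℂ)) ∧
        Summable (etaMuTerm eta mu w lamb tau s r)) ∧
      MeasureTheory.IntegrableOn
        (fun r : ℝ => (1 - phiEtaMu eta mu w lamb tau s r) * (r : ℂ))
        (Set.Ioi (cellRadius lamb)) ∧
      (laplaceTransform P (interference X L G lamb tau) s : ℂ) =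
        Complex.exp (-(2 * Real.pi * lamb *
          ∫ r : ℝ in Set.Ioi (cellRadius lamb),
            (1 - phiEtaMu eta mu w lamb tau s r) * (r : ℂ)))) := by
  have htau_pos : 0 < tau := by linarith
  have hR := cellRadius_pos hlamb
  refine ⟨fun kappa hk h => ?_, fun eta he h => ?_⟩
  · have hmix := isGammaMixture_kappaMuLaw hk hmu hw
    refine ⟨h.ae_summable hmix.ae_nonneg hmix.lintegral_id_ne_top hlamb htau, fun r hr =>
      ⟨fun n => meijerGWellDefined (by positivity) (by positivity)
        (kappaMuArg_pos hk hmu hw hlamb hs (hR.trans_le hr)), ?_⟩,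
      h.integrableOn_and_laplaceTransform_eq_cexp hmix.ae_nonneg hmix.lintegral_id_ne_top hlamb
        htau hs.le fun r hr => phiKappaMu_eq_markTransform hk hmu hw hlamb htau_pos hs
          (hR.trans hr) (h.markTransform_ne_top r)⟩
    exact (hasSum_kappaMuTerm hk hmu hw hlamb htau_pos hs (hR.trans_le hr)
      (h.markTransform_ne_top r)).summable
  · have hmix := isGammaMixture_etaMuLaw he hmu hw
    refine ⟨h.ae_summable hmix.ae_nonneg hmix.lintegral_id_ne_top hlamb htau, fun r hr =>
      ⟨fun n => meijerGWellDefined (by positivity) (by positivity)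
        (etaMuArg_pos he hmu hw hlamb hs (hR.trans_le hr)), ?_⟩,
      h.integrableOn_and_laplaceTransform_eq_cexp hmix.ae_nonneg hmix.lintegral_id_ne_top hlamb
        htau hs.le fun r hr => phiEtaMu_eq_markTransform he hmu hw hlamb htau_pos hs
          (hR.trans hr) (h.markTransform_ne_top r)⟩
    exact (hasSum_etaMuTerm he hmu hw hlamb htau_pos hs (hR.trans_le hr)
      (h.markTransform_ne_top r)).summable
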